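/- **Conventions.** Fix a notion of smallness (a universe); "accessible" for categories and functors is relative to it. Let $(\mathscr V,\otimes,\mathbf 1)$ be a monoidal category, not assumed symmetric, with all small limits and colimits, and let $\mathscr C$ be a category enriched in $\mathscr V$, with hom-objects $[X,Y]$, composition written in diagrammatic order $[X,Y]\otimes[Y,Z]\to[X,Z]$, and morphisms $X\to Y$ of the underlying category identified with morphisms $\mathbf 1\to[X,Y]$. (The other order of composition is obtained by replacing $\otimes$ with the reversed tensor product.) "$\mathscr V$ is closed" means that $M\otimes-$ has a right adjoint $A\mapsto A^M$ for every $M\in\mathscr V$. "$\mathscr C$ is tensored over $\mathscr V$" means that $\mathscr V$ is closed and that for all $M\in\mathscr V$, $X\in\mathscr C$ the $\mathscr V$-functor $Y\mapsto[X,Y]^M$ is $\mathscr V$-representable by an object $M\odot X$, i.e. there are isomorphisms $[M\odot X,Y]\cong[X,Y]^M$ that are $\mathscr V$-natural in $Y$. "$\mathscr C$ is accessibly tensored over $\mathscr V$" means that it is tensored, that $\mathscr V$ and $\mathscr C$ are accessible, and that the functor $M\odot-:\mathscr C\to\mathscr C$ is accessible for every $M\in\mathscr V$. For a monoid $M$ in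 $\mathscr V$, $\mathrm{Rep}(M)$ is the category whose objects are pairs $(X,\alpha)$ with $X\in\mathscr C$ and $\alpha:M\to[X,X]$ a morphism of monoids, and whose morphisms $(X,\alpha)\to(Y,\beta)$ are the morphisms $f:X\to Y$ of $\mathscr C$ with $f_*\circ\alpha=f^*\circ\beta:M\to[X,Y]$. If $\mathscr C$ is tensored, $M$ induces a monad $\widetilde M$ on $\mathscr C$ with underlying functor $X\mapsto M\odot X$: its unit $X\to M\odot X$ corresponds to $\mathbf 1\to M\to[X,M\odot X]$, and its multiplication $M\odot(M\odot X)\to M\odot X$ corresponds to $M\otimes M\to M\to[X,M\odot X]$ (where $M\to[X,M\odot X]$ is the universal element). **Lemma.** Suppose that $\mathscr C$ is accessibly tensored over $\mathscr V$, and let $M$ be a monoid in $\mathscr V$. Then: 1. the monad $\widetilde M$ is accessible; 2. there is an equivalence of categories from $\mathrm{Rep}(M)$ to the category of $\widetilde M$-modules that commutes strictly with the forgetful functors to $\mathscr C$ and sends $(X,\alpha)$ to $X$ with the module structure $M\odot X\to X$ that corresponds to $\alpha:M\to[X,X]$; 3. $\mathrm{Rep}(M)$ is an accessible category and the forgetful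 functor $\mathrm{Rep}(M)\to\mathscr C$ is accessible. -/

import Mathlib

open CategoryTheory MonoidalCategory Limits

universe w v' v u' u

namespace EnrichedRep

noncomputable section

section GeneralizedElements

variable {V : Type u'} [Category.{v'} V] [MonoidalCategory V]
  {C : Type u} [Category.{v} C] [EnrichedOrdinaryCategory V C]

/-- Composition of two generalized elements `A ⟶ [X, Y]` and `B ⟶ [Y, Z]` of hom-objects of a
`V`-category: the composite `A ⊗ B ⟶ [X, Y] ⊗ [Y, Z] ⟶ [X, Z]`. -/
def eStar {A B : V} {X Y Z : C} (f : A ⟶ (X ⟶[V] Y)) (g : B ⟶ (Y ⟶[V] Z)) :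
    A ⊗ B ⟶ (X ⟶[V] Z) :=
  (f ⊗ₘ g) ≫ eComp V X Y Z

lemma eStar_precomp {A B A' B' : V} {X Y Z : C} (a : A' ⟶ A) (b : B' ⟶ B)
    (f : A ⟶ (X ⟶[V] Y)) (g : B ⟶ (Y ⟶[V] Z)) :
    eStar (a ≫ f) (b ≫ g) = (a ⊗ₘ b) ≫ eStar f g := by
  simp only [eStar, ← tensorHom_comp_tensorHom, Category.assoc]

lemma eStar_assoc {A B D : V} {W X Y Z : C} (f : A ⟶ (W ⟶[V] X)) (g : B ⟶ (X ⟶[V] Y))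
    (h : D ⟶ (Y ⟶[V] Z)) :
    eStar f (eStar g h) = (α_ A B D).inv ≫ eStar (eStar f g) h := by
  simp only [eStar]
  have h1 : (f ⊗ₘ (g ⊗ₘ h) ≫ eComp V X Y Z) =
      (f ⊗ₘ (g ⊗ₘ h)) ≫ _ ◁ eComp V X Y Z := by
    rw [← id_tensorHom, tensorHom_comp_tensorHom, Category.comp_id]
  have h2 : ((f ⊗ₘ g) ≫ eComp V W X Y ⊗ₘ h) =
      ((f ⊗ₘ g) ⊗ₘ h) ≫ eComp V W X Y ▷ _ := by
    rw [← tensorHom_id, tensorHom_comp_tensorHom, Category.comp_id]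
  rw [h1, h2, Category.assoc, ← e_assoc, Category.assoc, associator_inv_naturality_assoc]

lemma eStar_whiskerLeft {A B : V} {X Y Z Z' : C} (f : A ⟶ (X ⟶[V] Y)) (g : B ⟶ (Y ⟶[V] Z))
    (k : Z ⟶ Z') :
    eStar f g ≫ eHomWhiskerLeft V X k = eStar f (g ≫ eHomWhiskerLeft V Y k) := by
  simp only [eStar, Category.assoc, eComp_eHomWhiskerLeft]
  rw [← id_tensorHom, tensorHom_comp_tensorHom_assoc, Category.comp_id]

lemma eStar_eHomEquiv {A : V} {X Y Z : C} (f : A ⟶ (X ⟶[V] Y)) (k : Y ⟶ Z) :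
    eStar f (eHomEquiv V k) = (ρ_ A).hom ≫ f ≫ eHomWhiskerLeft V X k := by
  simp [eStar, eHomWhiskerLeft, MonoidalCategory.tensorHom_def]

lemma eHomEquiv_eStar {A : V} {X Y Z : C} (k : X ⟶ Y) (f : A ⟶ (Y ⟶[V] Z)) :
    eStar (eHomEquiv V k) f = (λ_ A).hom ≫ f ≫ eHomWhiskerRight V k Z := by
  simp [eStar, eHomWhiskerRight, MonoidalCategory.tensorHom_def']

lemma eStar_exchange {A B : V} {X Y Y' Z : C} (f : A ⟶ (X ⟶[V] Y)) (k : Y ⟶ Y')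
    (g : B ⟶ (Y' ⟶[V] Z)) :
    eStar (f ≫ eHomWhiskerLeft V X k) g = eStar f (g ≫ eHomWhiskerRight V k Z) := by
  have h1 : f ≫ eHomWhiskerLeft V X k = (ρ_ A).inv ≫ eStar f (eHomEquiv V k) := by
    simp [eStar_eHomEquiv]
  have h2 : g ≫ eHomWhiskerRight V k Z = (λ_ B).inv ≫ eStar (eHomEquiv V k) g := by
    simp [eHomEquiv_eStar]
  have h3 := eStar_precomp (ρ_ A).inv (𝟙 B) (eStar f (eHomEquiv V k)) g
  have h4 := eStar_precomp (𝟙 A) (λ_ B).inv f (eStar (eHomEquiv V k) g)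
  rw [Category.id_comp] at h3 h4
  rw [h1, h2, h3, h4, eStar_assoc]
  simp

end GeneralizedElements

section Representations

variable {V : Type u'} [Category.{v'} V] [MonoidalCategory V]
  {C : Type u} [Category.{v} C] [EnrichedOrdinaryCategory V C]

variable (V) in
/-- The endomorphism monoid `[X, X]` of an object `X` of a `V`-category. -/
def endMon (X : C) : Mon V where
  X := X ⟶[V] X
  mon :=
    { one := eId V X
      mul := eComp V X X X
      one_mul := by
        rw [← cancel_epi (λ_ (X ⟶[V] X)).inv]
        simp
      mul_one := by
        rw [← cancel_epi (ρ_ (X ⟶[V] X)).inv]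
        simp
      mul_assoc := by
        rw [e_assoc'] }

variable (C) in
/-- A representation in `C` of a monoid `M` of `V`: an object `X` of `C` together with a morphism
of monoids `M ⟶ [X, X]`. -/
structure Rep (M : Mon V) where
  /-- the underlying object -/
  X : C
  /-- the action -/
  α : M ⟶ endMon V X

/-- The underlying morphism `M ⟶ [X, X]` of `V` of the action of a representation `(X, α)`. -/
def Rep.act {M : Mon V} (R : Rep C M) : M.X ⟶ (R.X ⟶[V] R.X) :=
  R.α.hom

/-- A morphism of representations `(X, α) ⟶ (Y, β)`: a morphism `f : X ⟶ Y` such that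
`f_* ∘ α = f^* ∘ β` as morphisms `M ⟶ [X, Y]`. -/
@[ext]
structure Rep.Hom {M : Mon V} (R S : Rep C M) where
  /-- the underlying morphism -/
  f : R.X ⟶ S.X
  comm : R.act ≫ eHomWhiskerLeft V R.X f = S.act ≫ eHomWhiskerRight V f S.X

instance (M : Mon V) : Category (Rep C M) where
  Hom R S := Rep.Hom R S
  id R := ⟨𝟙 R.X, by simp⟩
  comp {R S T} f g := ⟨f.f ≫ g.f, by
    rw [eHomWhiskerLeft_comp, ← Category.assoc, f.comm, Category.assoc,
      ← eHom_whisker_exchange, ← Category.assoc, g.comm, Category.assoc,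
      ← eHomWhiskerRight_comp]⟩
  id_comp f := Rep.Hom.ext (Category.id_comp _)
  comp_id f := Rep.Hom.ext (Category.comp_id _)
  assoc f g h := Rep.Hom.ext (Category.assoc _ _ _)

variable (C) in
/-- The forgetful functor `Rep M ⥤ C`. -/
def Rep.forget (M : Mon V) : Rep C M ⥤ C where
  obj R := R.X
  map f := f.f

end Representations

section Tensored

variable {V : Type u'} [Category.{v'} V] [MonoidalCategory V] [MonoidalClosed V]

/-- For `M : V` and `X, Y, Z : C`, the action `[X, Y]^M ⊗ [Y, Z] ⟶ [X, Z]^M` that makes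
`Y ↦ [X, Y]^M` a `V`-functor `C ⥤ V`; here `A^M = (ihom M).obj A` is the value at `A` of the right
adjoint of `M ⊗ -`. It is the transpose of
`M ⊗ ([X, Y]^M ⊗ [Y, Z]) ≅ (M ⊗ [X, Y]^M) ⊗ [Y, Z] ⟶ [X, Y] ⊗ [Y, Z] ⟶ [X, Z]`. -/
def powerComp (M : V) {C : Type u} [EnrichedCategory V C] (X Y Z : C) :
    (ihom M).obj (X ⟶[V] Y) ⊗ (Y ⟶[V] Z) ⟶ (ihom M).obj (X ⟶[V] Z) :=
  MonoidalClosed.curry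
    ((α_ M ((ihom M).obj (X ⟶[V] Y)) (Y ⟶[V] Z)).inv ≫
      (ihom.ev M).app (X ⟶[V] Y) ▷ (Y ⟶[V] Z) ≫ eComp V X Y Z)

variable (V) in
/-- A tensored `V`-category, for `V` a closed monoidal category: for every `M : V` and `X : C`, the
`V`-functor `Y ↦ [X, Y]^M` is `V`-representable by an object `M ⊙ X` of `C`. The representation is
an isomorphism `[M ⊙ X, Y] ≅ [X, Y]^M`, `V`-natural in `Y`: it commutes with the actions of the
hom-objects `[Y, Z]`. -/
class Tensored (C : Type u) [EnrichedCategory V C] where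
  /-- the tensor `M ⊙ X` -/
  obj : V → C → C
  /-- the isomorphism `[M ⊙ X, Y] ≅ [X, Y]^M` -/
  homIso (M : V) (X Y : C) : (obj M X ⟶[V] Y) ≅ (ihom M).obj (X ⟶[V] Y)
  /-- `V`-naturality -/
  homIso_natural (M : V) (X Y Z : C) :
    eComp V (obj M X) Y Z ≫ (homIso M X Z).hom =
      (homIso M X Y).hom ▷ (Y ⟶[V] Z) ≫ powerComp M X Y Z

variable {C : Type u} [Category.{v} C] [EnrichedOrdinaryCategory V C] [Tensored V C]

/-- The universal element `M ⟶ [X, M ⊙ X]`, which corresponds to the identity of `M ⊙ X`. -/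
def tensorUnit (M : V) (X : C) : M ⟶ (X ⟶[V] Tensored.obj M X) :=
  (ρ_ M).inv ≫
    MonoidalClosed.uncurry (eId V (Tensored.obj M X) ≫ (Tensored.homIso M X _).hom)

lemma uncurry_homIso (M : V) (X Y : C) :
    MonoidalClosed.uncurry (Tensored.homIso M X Y).hom =
      tensorUnit M X ▷ _ ≫ eComp V X (Tensored.obj M X) Y := by
  have h : (Tensored.homIso M X Y).hom = (λ_ _).inv ≫
      (eId V (Tensored.obj M X) ≫ (Tensored.homIso M X _).hom) ▷ _ ≫
        powerComp M X (Tensored.obj M X) Y := by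
    rw [comp_whiskerRight, Category.assoc, ← Tensored.homIso_natural, e_id_comp_assoc]
  rw [h, MonoidalClosed.uncurry_natural_left, MonoidalClosed.uncurry_natural_left]
  simp only [powerComp, tensorUnit, MonoidalClosed.uncurry_eq,
    comp_whiskerRight, MonoidalCategory.whiskerLeft_comp, Category.assoc, whisker_assoc]
  simp

/-- A generalized element of `[M ⊙ X, Y]` obtained from a generalized element of `[X, Y]`. -/
def tensorCurry (M : V) {N : V} {X Y : C} (f : M ⊗ N ⟶ (X ⟶[V] Y)) :
    N ⟶ (Tensored.obj M X ⟶[V] Y) :=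
  MonoidalClosed.curry f ≫ (Tensored.homIso M X Y).inv

lemma eStar_tensorUnit {M N : V} {X Y : C} (g : N ⟶ (Tensored.obj M X ⟶[V] Y)) :
    eStar (tensorUnit M X) g =
      MonoidalClosed.uncurry (g ≫ (Tensored.homIso M X Y).hom) := by
  rw [MonoidalClosed.uncurry_natural_left, uncurry_homIso, eStar, MonoidalCategory.tensorHom_def',
    Category.assoc]

lemma eStar_tensorCurry {M N : V} {X Y : C} (f : M ⊗ N ⟶ (X ⟶[V] Y)) :
    eStar (tensorUnit M X) (tensorCurry M f) = f := by
  simp [eStar_tensorUnit, tensorCurry]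

lemma eStar_ext {M N : V} {X Y : C} {f g : N ⟶ (Tensored.obj M X ⟶[V] Y)}
    (h : eStar (tensorUnit M X) f = eStar (tensorUnit M X) g) : f = g := by
  rw [eStar_tensorUnit, eStar_tensorUnit] at h
  exact (cancel_mono _).1 (MonoidalClosed.uncurry_injective h)

/-- The morphism `M ⊙ X ⟶ Y` of `C` that corresponds to a morphism `M ⟶ [X, Y]` of `V`. -/
def tensorDesc {M : V} {X Y : C} (f : M ⟶ (X ⟶[V] Y)) : Tensored.obj M X ⟶ Y :=
  (eHomEquiv V).symm (tensorCurry M ((ρ_ M).hom ≫ f))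

lemma tensorUnit_desc {M : V} {X Y : C} (f : M ⟶ (X ⟶[V] Y)) :
    tensorUnit M X ≫ eHomWhiskerLeft V X (tensorDesc f) = f := by
  have h := eStar_eHomEquiv (tensorUnit M X) (tensorDesc f)
  rw [tensorDesc, Equiv.apply_symm_apply, eStar_tensorCurry] at h
  exact ((cancel_epi _).1 h).symm

lemma tensor_hom_ext {M : V} {X Y : C} {f g : Tensored.obj M X ⟶ Y}
    (h : tensorUnit M X ≫ eHomWhiskerLeft V X f = tensorUnit M X ≫ eHomWhiskerLeft V X g) :
    f = g := by
  apply (eHomEquiv V).injective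
  apply eStar_ext
  rw [eStar_eHomEquiv, eStar_eHomEquiv, h]

/-- The action of the functor `M ⊙ -` on morphisms. -/
def tensorMap (M : V) {X Y : C} (f : X ⟶ Y) : Tensored.obj M X ⟶ Tensored.obj M Y :=
  tensorDesc (tensorUnit M Y ≫ eHomWhiskerRight V f _)

lemma tensorUnit_map (M : V) {X Y : C} (f : X ⟶ Y) :
    tensorUnit M X ≫ eHomWhiskerLeft V X (tensorMap M f) =
      tensorUnit M Y ≫ eHomWhiskerRight V f _ :=
  tensorUnit_desc _

variable (C) in
/-- The functor `M ⊙ - : C ⥤ C`. -/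
def tensorFunctor (M : V) : C ⥤ C where
  obj X := Tensored.obj M X
  map f := tensorMap M f
  map_id X := tensor_hom_ext (by rw [tensorUnit_map]; simp)
  map_comp f g := tensor_hom_ext (by
    rw [tensorUnit_map, eHomWhiskerLeft_comp, ← Category.assoc, tensorUnit_map, Category.assoc,
      ← eHom_whisker_exchange, ← Category.assoc, tensorUnit_map, Category.assoc,
      eHomWhiskerRight_comp])

/-- The unit `X ⟶ M ⊙ X`, which corresponds to `𝟙_ V ⟶ M ⟶ [X, M ⊙ X]`. -/
def monadUnit (M : Mon V) (X : C) : X ⟶ Tensored.obj M.X X :=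
  (eHomEquiv V).symm (MonObj.one (X := M.X) ≫ tensorUnit M.X X)

/-- The multiplication `M ⊙ (M ⊙ X) ⟶ M ⊙ X`. Morphisms `M ⊙ (M ⊙ X) ⟶ Y` correspond to morphisms
`M ⊗ M ⟶ [X, Y]`, and this is the one that corresponds to `M ⊗ M ⟶ M ⟶ [X, M ⊙ X]`. -/
def monadMul (M : Mon V) (X : C) :
    Tensored.obj M.X (Tensored.obj M.X X) ⟶ Tensored.obj M.X X :=
  tensorDesc (tensorCurry M.X (MonObj.mul (X := M.X) ≫ tensorUnit M.X X))

lemma eHomEquiv_monadUnit (M : Mon V) (X : C) :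
    eHomEquiv V (monadUnit M X) = MonObj.one (X := M.X) ≫ tensorUnit M.X X := by
  simp [monadUnit]

lemma eStar_monadMul (M : Mon V) (X : C) :
    eStar (tensorUnit M.X X)
      (tensorUnit M.X (Tensored.obj M.X X) ≫ eHomWhiskerLeft V _ (monadMul M X)) =
      MonObj.mul (X := M.X) ≫ tensorUnit M.X X := by
  rw [monadMul, tensorUnit_desc, eStar_tensorCurry]

lemma tensorUnit_monadUnit (M : Mon V) (X : C) :
    tensorUnit M.X X ≫ eHomWhiskerLeft V X (monadUnit M (Tensored.obj M.X X)) =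
      (ρ_ M.X).inv ≫ M.X ◁ MonObj.one (X := M.X) ≫
        eStar (tensorUnit M.X X) (tensorUnit M.X (Tensored.obj M.X X)) := by
  have h := eStar_precomp (𝟙 M.X) (MonObj.one (X := M.X)) (tensorUnit M.X X)
    (tensorUnit M.X (Tensored.obj M.X X))
  rw [← eHomEquiv_monadUnit, eStar_eHomEquiv, Category.id_comp, id_tensorHom] at h
  rw [← h, Iso.inv_hom_id_assoc]

lemma monadUnit_tensorUnit (M : Mon V) (X : C) :
    tensorUnit M.X (Tensored.obj M.X X) ≫ eHomWhiskerRight V (monadUnit M X) _ =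
      (λ_ M.X).inv ≫ MonObj.one (X := M.X) ▷ M.X ≫
        eStar (tensorUnit M.X X) (tensorUnit M.X (Tensored.obj M.X X)) := by
  have h := eStar_precomp (MonObj.one (X := M.X)) (𝟙 M.X) (tensorUnit M.X X)
    (tensorUnit M.X (Tensored.obj M.X X))
  rw [← eHomEquiv_monadUnit, eHomEquiv_eStar, Category.id_comp, tensorHom_id] at h
  rw [← h, Iso.inv_hom_id_assoc]

lemma tensorMap_monadUnit (M : Mon V) {X Y : C} (f : X ⟶ Y) :
    f ≫ monadUnit M Y = monadUnit M X ≫ tensorMap M.X f := by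
  apply (eHomEquiv V).injective
  have h1 : eHomEquiv V (f ≫ monadUnit M Y) =
      eHomEquiv V (monadUnit M Y) ≫ eHomWhiskerRight V f _ := by
    rw [eHomEquiv_comp]
    change (λ_ _).inv ≫ eStar _ _ = _
    rw [eHomEquiv_eStar, Iso.inv_hom_id_assoc]
  have h2 : eHomEquiv V (monadUnit M X ≫ tensorMap M.X f) =
      eHomEquiv V (monadUnit M X) ≫ eHomWhiskerLeft V _ (tensorMap M.X f) := by
    rw [eHomEquiv_comp]
    change (λ_ _).inv ≫ eStar _ _ = _
    rw [eStar_eHomEquiv, ← unitors_equal, Iso.inv_hom_id_assoc]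
  rw [h1, h2, eHomEquiv_monadUnit, eHomEquiv_monadUnit, Category.assoc, Category.assoc,
    tensorUnit_map]

lemma tensorMap_monadMul (M : Mon V) {X Y : C} (f : X ⟶ Y) :
    tensorMap M.X (tensorMap M.X f) ≫ monadMul M Y = monadMul M X ≫ tensorMap M.X f := by
  apply tensor_hom_ext
  apply eStar_ext
  have h : ∀ {A B : V} {Z W : C} (a : A ⟶ (Y ⟶[V] Z)) (b : B ⟶ (Z ⟶[V] W)),
      eStar (a ≫ eHomWhiskerRight V f Z) b = eStar a b ≫ eHomWhiskerRight V f W := by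
    intro A B Z W a b
    simp only [eStar, Category.assoc, eComp_eHomWhiskerRight]
    rw [← tensorHom_id, tensorHom_comp_tensorHom_assoc, Category.comp_id]
  have hl : eStar (tensorUnit M.X X) (tensorUnit M.X (Tensored.obj M.X X) ≫
      eHomWhiskerLeft V _ (tensorMap M.X (tensorMap M.X f) ≫ monadMul M Y)) =
      MonObj.mul (X := M.X) ≫ tensorUnit M.X Y ≫ eHomWhiskerRight V f _ := by
    rw [eHomWhiskerLeft_comp, ← Category.assoc, tensorUnit_map, Category.assoc,
      ← eHom_whisker_exchange, ← Category.assoc, ← eStar_exchange, tensorUnit_map, h,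
      eStar_monadMul, Category.assoc]
  have hr : eStar (tensorUnit M.X X) (tensorUnit M.X (Tensored.obj M.X X) ≫
      eHomWhiskerLeft V _ (monadMul M X ≫ tensorMap M.X f)) =
      MonObj.mul (X := M.X) ≫ tensorUnit M.X Y ≫ eHomWhiskerRight V f _ := by
    rw [eHomWhiskerLeft_comp, ← Category.assoc, ← eStar_whiskerLeft, eStar_monadMul,
      Category.assoc, tensorUnit_map]
  rw [hl, hr]

variable (C) in
/-- The monad on `C` induced by a monoid `M` of `V`, with underlying functor `X ↦ M ⊙ X`. -/
def tensorMonad (M : Mon V) : Monad C where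
  toFunctor := tensorFunctor C M.X
  η :=
    { app := fun X => monadUnit M X
      naturality := fun _ _ f => tensorMap_monadUnit M f }
  μ :=
    { app := fun X => monadMul M X
      naturality := fun _ _ f => tensorMap_monadMul M f }
  left_unit X := by
    change monadUnit M (Tensored.obj M.X X) ≫ monadMul M X = 𝟙 (Tensored.obj M.X X)
    apply tensor_hom_ext
    rw [eHomWhiskerLeft_comp, ← Category.assoc, tensorUnit_monadUnit]
    simp only [Category.assoc]
    rw [eStar_whiskerLeft, eStar_monadMul]
    simp
  right_unit X := by
    change tensorMap M.X (monadUnit M X) ≫ monadMul M X = 𝟙 (Tensored.obj M.X X)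
    apply tensor_hom_ext
    rw [eHomWhiskerLeft_comp, ← Category.assoc, tensorUnit_map, monadUnit_tensorUnit]
    simp only [Category.assoc]
    rw [eStar_whiskerLeft, eStar_monadMul]
    simp
  assoc X := by
    change tensorMap M.X (monadMul M X) ≫ monadMul M X =
      monadMul M (Tensored.obj M.X X) ≫ monadMul M X
    apply tensor_hom_ext
    apply eStar_ext
    apply eStar_ext
    have hl : eStar (tensorUnit M.X X)
        (eStar (tensorUnit M.X (Tensored.obj M.X X))
          (tensorUnit M.X (Tensored.obj M.X (Tensored.obj M.X X)) ≫
            eHomWhiskerLeft V _ (tensorMap M.X (monadMul M X) ≫ monadMul M X))) =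
        (α_ _ _ _).inv ≫ MonObj.mul (X := M.X) ▷ M.X ≫ MonObj.mul (X := M.X) ≫
          tensorUnit M.X X := by
      rw [eHomWhiskerLeft_comp, ← Category.assoc, tensorUnit_map, Category.assoc,
        ← eHom_whisker_exchange, ← Category.assoc, ← eStar_exchange, eStar_assoc,
        eStar_monadMul]
      have h := eStar_precomp (MonObj.mul (X := M.X)) (𝟙 M.X) (tensorUnit M.X X)
        (tensorUnit M.X (Tensored.obj M.X X) ≫ eHomWhiskerLeft V _ (monadMul M X))
      rw [Category.id_comp, tensorHom_id] at h
      rw [h, eStar_monadMul]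
    have hr : eStar (tensorUnit M.X X)
        (eStar (tensorUnit M.X (Tensored.obj M.X X))
          (tensorUnit M.X (Tensored.obj M.X (Tensored.obj M.X X)) ≫
            eHomWhiskerLeft V _ (monadMul M (Tensored.obj M.X X) ≫ monadMul M X))) =
        M.X ◁ MonObj.mul (X := M.X) ≫ MonObj.mul (X := M.X) ≫ tensorUnit M.X X := by
      rw [eHomWhiskerLeft_comp, ← Category.assoc, ← eStar_whiskerLeft, eStar_monadMul,
        Category.assoc]
      have h := eStar_precomp (𝟙 M.X) (MonObj.mul (X := M.X)) (tensorUnit M.X X)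
        (tensorUnit M.X (Tensored.obj M.X X) ≫ eHomWhiskerLeft V _ (monadMul M X))
      rw [Category.id_comp, id_tensorHom] at h
      rw [h, eStar_monadMul]
    rw [hl, hr]
    simp

/-- The morphism `M ⊙ X ⟶ X` that corresponds to the action `α : M ⟶ [X, X]` of a representation
`(X, α)`. -/
def Rep.transpose {M : Mon V} (R : Rep C M) : (tensorMonad C M).toFunctor.obj R.X ⟶ R.X :=
  tensorDesc R.act

variable (V C) in
/-- `C` is accessibly tensored over `V` (relative to `w`-small cardinals): it is tensored, `V` and
`C` are accessible categories, and all functors `M ⊙ - : C ⥤ C` are accessible. -/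
class IsAccessiblyTensored : Prop where
  accessible_base : IsAccessibleCategory.{w} V
  accessible : IsAccessibleCategory.{w} C
  accessible_tensorFunctor (M : V) : (tensorFunctor C M).IsAccessible.{w}

end Tensored

end

end EnrichedRep

/-! Accessibility of `tensorMonad C M` is part of the hypothesis. The universal property of `M ⊙ X`
makes maps `M ⟶ [X, X]` and `M ⊙ X ⟶ X` correspond, and under this transposition the monoid-morphism
laws become the module laws. This gives the equivalence over `C`. It remains to show that the
algebras of an accessible monad `T` on an accessible category form an accessible category with
accessible forgetful functor.

Filtered colimits of algebras are computed in `C` as soon as `T` preserves them; the work is to find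
a generator. Choose `κ` such that `C` and `T` are `κ`-accessible, then a larger `κ'`, the successor
of some `μ` with `μ ^ κ ≤ μ`, such that `T` preserves `κ'`-presentable objects. An algebra whose
underlying object is `κ'`-presentable is then `κ'`-presentable, and these algebras generate. Indeed,
write `A` as the colimit of `κ'`-presentable objects `F x` over a `κ'`-directed poset.
Presentability of `T (F x)` and `T (T (F x))` lets the structure map and each instance of its laws
be realized at some later index. Since `μ ^ κ ≤ μ`, every subset of size `< κ'` lies in one of size
`< κ'` which is `κ`-directed and contains the indices needed. `T` preserves the colimit over such a
subset, so this colimit is an algebra; being a `κ'`-small colimit, it is `κ'`-presentable. The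
subsets form a `κ'`-directed family, and `A` is the colimit of these algebras
(`isCardinalFilteredGenerator_algebra`).

The same argument without algebra structure raises the index of accessibility of `C`
(`isCardinalFilteredGenerator_of_dominates`). -/

namespace AccessibleMonad

open Cardinal

/-! ### Closing small subsets under operations of large arity. -/

section ClosedSets

/-- A set of cardinality `≤ μ` is contained in a set of cardinality `≤ μ` that is closed under a
given family of at most `μ` operations of arity `K`, provided that `μ ^ #K ≤ μ`. -/
lemma exists_closed_set {X I K : Type w} (op : I → (K → X) → X) {μ : Cardinal.{w}}
    (h₀ : ℵ₀ ≤ μ) (hI : #I ≤ μ) (hK : μ ^ #K ≤ μ) (A : Set X) (hA : #A ≤ μ) :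
    ∃ B : Set X, A ⊆ B ∧ #B ≤ μ ∧ ∀ (i : I) (f : K → X), (∀ k, f k ∈ B) → op i f ∈ B := by
  -- Formal terms: constants from `A`, and operations from `I` with arity `K`. The closure is the
  -- set of their values, and `μ` bounds the number of terms because it absorbs the polynomial
  -- functor that defines them.
  let β : A ⊕ I → Type w := Sum.elim (fun _ => PEmpty) (fun _ => K)
  let ev : WType β → X := WType.elim X fun x => match x with
    | ⟨Sum.inl a, _⟩ => a.1
    | ⟨Sum.inr i, f⟩ => op i f
  have hW : #(WType β) ≤ μ := by
    apply WType.cardinalMk_le_of_le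
    have h (a : A ⊕ I) : μ ^ #(β a) ≤ μ := by
      obtain a | i := a
      · simpa [β] using one_le_aleph0.trans h₀
      · exact hK
    refine (sum_le_sum _ (fun _ => μ) h).trans ?_
    rw [sum_const', mk_sum, lift_id, lift_id]
    exact mul_le_of_le h₀ (add_le_of_le h₀ hA hI) le_rfl
  refine ⟨Set.range ev, fun a ha => ⟨WType.mk (Sum.inl ⟨a, ha⟩) PEmpty.elim, rfl⟩,
    mk_range_le.trans hW, fun i f hf => ?_⟩
  choose g hg using hf
  refine ⟨WType.mk (Sum.inr i) g, ?_⟩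
  change op i (fun k => ev (g k)) = op i f
  simp only [hg]

/-- A subset `B` is `κ`-closed for a relation `G` between subsets and elements if all subsets of
`B` of cardinality `< κ` are related to an element of `B`. -/
def IsClosedFor (κ : Cardinal.{w}) {X : Type w} (G : Set X → X → Prop) (B : Set X) : Prop :=
  ∀ S : Set X, S ⊆ B → #S < κ → ∃ z ∈ B, G S z

/-- A nonempty set of size `< κ` is the range of a map from `κ`, so choosing a related element
becomes one operation of arity `κ`; `φ` becomes a second one that reads a single argument. -/
lemma exists_isClosedFor {X : Type w} {κ μ : Cardinal.{w}} (h₀ : ℵ₀ ≤ μ) (hκ : μ ^ κ ≤ μ)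
    {G : Set X → X → Prop} (hG : ∀ S : Set X, #S < κ → ∃ z, G S z) (φ : X → X)
    (A : Set X) (hA : #A ≤ μ) :
    ∃ B : Set X, A ⊆ B ∧ #B ≤ μ ∧ IsClosedFor κ G B ∧ ∀ x ∈ B, φ x ∈ B := by
  classical
  obtain rfl | hκ₀ := eq_or_ne κ 0
  · obtain ⟨B, hAB, hB, h⟩ := exists_closed_set (I := PUnit.{w + 1}) (K := PUnit.{w + 1})
      (fun _ f => φ (f ⟨⟩)) h₀ (by simpa using one_le_aleph0.trans h₀) (by simp) A hA
    exact ⟨B, hAB, hB, fun S _ hS => absurd hS (by simp), fun x hx => h ⟨⟩ (fun _ => x) (by simpa)⟩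
  -- `z₀` serves the empty set, which is not the range of a map from `κ`, and is the default value
  -- of the operation on families with too large a range.
  obtain ⟨z₀, hz₀⟩ := hG ∅ (by simpa using hκ₀.bot_lt)
  have hK : #κ.ord.ToType = κ := by simp
  have : Nonempty κ.ord.ToType := by rw [← mk_ne_zero_iff, hK]; exact hκ₀
  choose g hg using hG
  let op : ULift.{w} Bool → (κ.ord.ToType → X) → X := fun b f =>
    if b.down then φ (f (Classical.arbitrary _))
    else if h : #(Set.range f) < κ then g _ h else z₀
  obtain ⟨B, hAB, hB, h⟩ := exists_closed_set op h₀
    ((lt_aleph0_of_finite _).le.trans h₀) (by rwa [hK]) (insert z₀ A)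
    ((mk_insert_le).trans (add_le_of_le h₀ hA (one_le_aleph0.trans h₀)))
  refine ⟨B, (Set.subset_insert _ _).trans hAB, hB, fun S hSB hS => ?_, fun x hx => ?_⟩
  · obtain rfl | hne := S.eq_empty_or_nonempty
    · exact ⟨z₀, hAB (Set.mem_insert _ _), hz₀⟩
    · have := hne.to_subtype
      obtain ⟨f, hf⟩ : ∃ f : κ.ord.ToType → S, Function.Surjective f := by
        obtain ⟨e⟩ : #S ≤ #κ.ord.ToType := hK.symm ▸ hS.le
        exact ⟨_, Function.invFun_surjective e.injective⟩
      have hr : Set.range (fun k => (f k : X)) = S := by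
        rw [Set.range_comp' Subtype.val f, hf.range_eq]; simp
      have h1 := h ⟨false⟩ (fun k => f k) (fun k => hSB (f k).2)
      have hc : #(Set.range (fun k => (f k : X))) < κ := by rwa [hr]
      simp only [op, Bool.false_eq_true, if_false, dif_pos hc] at h1
      refine ⟨_, h1, ?_⟩
      convert hg _ hc
      exact hr.symm
  · simpa [op] using h ⟨true⟩ (fun _ => x) (fun _ => hx)

lemma power_two_power_max {κ : Cardinal.{w}} (hκ : ℵ₀ ≤ κ) (θ : Cardinal.{w}) :
    ((2 : Cardinal.{w}) ^ (max κ θ)) ^ κ ≤ 2 ^ (max κ θ) := by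
  rw [← power_mul, mul_eq_left (hκ.trans (le_max_left _ _)) (le_max_left _ _)
    (aleph0_pos.trans_le hκ).ne']

lemma le_of_power_le {κ μ : Cardinal.{w}} (h₀ : ℵ₀ ≤ μ) (h : μ ^ κ ≤ μ) : κ ≤ μ :=
  (cantor' κ (one_lt_aleph0.trans_le h₀)).le.trans h

end ClosedSets

/-! ### Pairs of cardinals between which accessibility can be raised. -/

section Dominates

/-- The regular cardinal `κ'` is the successor of an infinite cardinal `μ` such that
`μ ^ κ ≤ μ`. (This is a sufficient condition for `κ` to be sharply smaller than `κ'`.) -/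
def Dominates (κ κ' : Cardinal.{w}) : Prop :=
  ∃ μ : Cardinal.{w}, ℵ₀ ≤ μ ∧ μ ^ κ ≤ μ ∧ κ' = Order.succ μ

/-- The cardinal `2 ^ max κ θ` is unchanged by raising to the power `κ`, since `max κ θ * κ = max κ
θ`; its successor is regular. -/
lemma exists_dominates {κ : Cardinal.{w}} (hκ : ℵ₀ ≤ κ) (θ : Cardinal.{w}) :
    ∃ κ' : Cardinal.{w}, κ'.IsRegular ∧ θ ≤ κ' ∧ Dominates κ κ' := by
  have h₁ : max κ θ ≤ 2 ^ max κ θ := (cantor _).le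
  have h₀ : ℵ₀ ≤ 2 ^ max κ θ := hκ.trans ((le_max_left _ _).trans h₁)
  exact ⟨_, isRegular_succ h₀, ((le_max_right _ _).trans h₁).trans (Order.le_succ _),
    _, h₀, power_two_power_max hκ θ, rfl⟩

lemma Dominates.le {κ κ' : Cardinal.{w}} (h : Dominates κ κ') : κ ≤ κ' := by
  obtain ⟨μ, h₀, hμ, rfl⟩ := h
  exact (le_of_power_le h₀ hμ).trans (Order.le_succ _)

lemma Dominates.exists_isClosedFor {κ κ' : Cardinal.{w}} (h : Dominates κ κ') {X : Type w}
    {G : Set X → X → Prop} (hG : ∀ S : Set X, #S < κ → ∃ z, G S z) (φ : X → X)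
    (A : Set X) (hA : HasCardinalLT A κ') :
    ∃ B : Set X, A ⊆ B ∧ HasCardinalLT B κ' ∧ IsClosedFor κ G B ∧ ∀ x ∈ B, φ x ∈ B := by
  obtain ⟨μ, h₀, hμ, rfl⟩ := h
  simp only [hasCardinalLT_iff_cardinal_mk_lt, Order.lt_succ_iff] at hA ⊢
  exact AccessibleMonad.exists_isClosedFor h₀ hμ hG φ A hA

lemma IsClosedFor.isCardinalFiltered {κ : Cardinal.{w}} [Fact κ.IsRegular] {X : Type w}
    [PartialOrder X] {G : Set X → X → Prop} {B : Set X} (hB : IsClosedFor κ G B)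
    (hG : ∀ S z, G S z → ∀ x ∈ S, x ≤ z) : IsCardinalFiltered B κ :=
  isCardinalFiltered_preorder _ _ fun K f hK => by
    obtain ⟨z, hz, h⟩ := hB (Set.range fun k => (f k : X)) (by rintro _ ⟨k, rfl⟩; exact (f k).2)
      (mk_range_le.trans_lt hK)
    exact ⟨⟨z, hz⟩, fun k => hG _ _ h _ ⟨k, rfl⟩⟩

end Dominates

/-! ### Colimits over subsets of the index poset. -/

section PartialColimits

variable {C : Type u} [Category.{v} C] {X : Type w} [PartialOrder X] (F : X ⥤ C)

/-- The restriction of a diagram indexed by a poset to a subset. -/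
abbrev restrict (B : Set X) : B ⥤ C := (Subtype.mono_coe (· ∈ B)).functor ⋙ F

/-- The morphism between the colimits over a subset and over a larger one. -/
noncomputable def restrictMap {B B' : Set X} (h : B ⊆ B') [HasColimit (restrict F B)]
    [HasColimit (restrict F B')] : colimit (restrict F B) ⟶ colimit (restrict F B') :=
  colimit.desc (restrict F B)
    { pt := colimit (restrict F B')
      ι :=
        { app := fun x => colimit.ι (restrict F B') ⟨x.1, h x.2⟩
          naturality := fun x y f =>
            (colimit.w (restrict F B') (homOfLE
              (show (⟨x.1, h x.2⟩ : B') ≤ ⟨y.1, h y.2⟩ from leOfHom f))).trans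
                (Category.comp_id _).symm } }

lemma ι_restrictMap {B B' : Set X} (h : B ⊆ B') [HasColimit (restrict F B)]
    [HasColimit (restrict F B')] (x : B) :
    colimit.ι (restrict F B) x ≫ restrictMap F h = colimit.ι (restrict F B') ⟨x.1, h x.2⟩ :=
  colimit.ι_desc _ _

variable (P : Set X → Prop) [∀ B : Subtype P, HasColimit (restrict F B.1)]

/-- The functor sending a subset of `X` to the colimit over this subset. -/
noncomputable def partialColimit : Subtype P ⥤ C where
  obj B := colimit (restrict F B.1)
  map h := restrictMap F (leOfHom h)
  map_id B := colimit.hom_ext fun x => by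
    rw [ι_restrictMap]
    exact (Category.comp_id _).symm
  map_comp f g := colimit.hom_ext fun x => by
    rw [ι_restrictMap, ← Category.assoc, ι_restrictMap]
    exact (ι_restrictMap F (leOfHom g) ⟨x.1, leOfHom f x.2⟩).symm

/-- The coprojection to the colimit over a subset. -/
noncomputable def partialι (B : Subtype P) (x : X) (hx : x ∈ B.1) :
    F.obj x ⟶ (partialColimit F P).obj B :=
  colimit.ι (restrict F B.1) ⟨x, hx⟩

variable {F P} in
lemma partial_hom_ext {B : Subtype P} {Z : C} {f g : (partialColimit F P).obj B ⟶ Z}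
    (h : ∀ x hx, partialι F P B x hx ≫ f = partialι F P B x hx ≫ g) : f = g :=
  colimit.hom_ext fun x => h x.1 x.2

@[simp]
lemma map_partialι (B : Subtype P) {x y : X} (f : x ⟶ y) (hx : x ∈ B.1) (hy : y ∈ B.1) :
    F.map f ≫ partialι F P B y hy = partialι F P B x hx :=
  colimit.w (restrict F B.1)
    (homOfLE (show (⟨x, hx⟩ : B.1) ≤ ⟨y, hy⟩ from leOfHom f))

@[simp]
lemma partialι_map {B B' : Subtype P} (h : B ⟶ B') (x : X) (hx : x ∈ B.1) :
    partialι F P B x hx ≫ (partialColimit F P).map h = partialι F P B' x (leOfHom h hx) :=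
  ι_restrictMap F (leOfHom h) ⟨x, hx⟩

variable {F}

variable {P} in
/-- Morphisms from the colimit over a subset. -/
noncomputable def partialDesc {B : Subtype P} {Z : C} (f : ∀ x ∈ B.1, F.obj x ⟶ Z)
    (hf : ∀ x hx y hy (h : x ⟶ y), F.map h ≫ f y hy = f x hx) :
    (partialColimit F P).obj B ⟶ Z :=
  colimit.desc (restrict F B.1)
    { pt := Z
      ι :=
        { app := fun x => f x.1 x.2
          naturality := fun x y h =>
            (hf x.1 x.2 y.1 y.2 (homOfLE (leOfHom h))).trans (Category.comp_id _).symm } }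

variable {P} in
@[simp]
lemma partialι_desc {B : Subtype P} {Z : C} (f : ∀ x ∈ B.1, F.obj x ⟶ Z)
    (hf : ∀ x hx y hy (h : x ⟶ y), F.map h ≫ f y hy = f x hx) (x : X) (hx : x ∈ B.1) :
    partialι F P B x hx ≫ partialDesc f hf = f x hx :=
  colimit.ι_desc _ _

/-- The morphism from a partial colimit to the point of a cocone over the whole diagram. -/
noncomputable def partialToPt (c : Cocone F) (B : Subtype P) :
    (partialColimit F P).obj B ⟶ c.pt :=
  partialDesc (fun x _ => c.ι.app x) (fun _ _ _ _ h => c.w h)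

@[simp]
lemma partialι_toPt (c : Cocone F) (B : Subtype P) (x : X) (hx : x ∈ B.1) :
    partialι F P B x hx ≫ partialToPt P c B = c.ι.app x :=
  partialι_desc _ _ _ _

@[simp]
lemma map_partialToPt (c : Cocone F) {B B' : Subtype P} (h : B ⟶ B') :
    (partialColimit F P).map h ≫ partialToPt P c B' = partialToPt P c B :=
  partial_hom_ext fun x hx => by rw [← Category.assoc, partialι_map, partialι_toPt, partialι_toPt]

/-- The cocone over the partial colimits induced by a cocone over the whole diagram. -/
noncomputable def partialCocone (c : Cocone F) : Cocone (partialColimit F P) where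
  pt := c.pt
  ι :=
    { app := fun B => partialToPt P c B
      naturality := fun _ _ h => (map_partialToPt P c h).trans (Category.comp_id _).symm }

variable {P}

-- By regularity, a union of fewer than `κ'` sets of size `< κ'` has size `< κ'`, and so lies in a
-- member of the family.
omit [PartialOrder X] in
lemma isCardinalFiltered_subtype {κ' : Cardinal.{w}} [Fact κ'.IsRegular]
    (hP : ∀ B, P B → HasCardinalLT B κ')
    (hP' : ∀ A : Set X, HasCardinalLT A κ' → ∃ B, A ⊆ B ∧ P B) :
    IsCardinalFiltered (Subtype P) κ' :=
  isCardinalFiltered_preorder _ _ fun K f hK => by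
    obtain ⟨B, hB, h⟩ := hP' (⋃ k, (f k).1) (hasCardinalLT_iUnion _
      (by rwa [hasCardinalLT_iff_cardinal_mk_lt]) fun k => hP _ (f k).2)
    exact ⟨⟨B, h⟩, fun k => (Set.subset_iUnion (fun k => (f k).1) k).trans hB⟩

/-- The colimit of a diagram indexed by a poset is the colimit of the partial colimits over
a sufficiently large family of subsets. -/
noncomputable def isColimitPartialCocone {c : Cocone F} (hc : IsColimit c)
    (hP : ∀ x y : X, ∃ B, P B ∧ x ∈ B ∧ y ∈ B)
    (hP' : ∀ B B' : Subtype P, ∃ B'' : Subtype P, B ≤ B'' ∧ B' ≤ B'') :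
    IsColimit (partialCocone P c) := by
  -- The leg at `x` does not depend on the subset through which it is computed, because the family
  -- is directed.
  have hι (s : Cocone (partialColimit F P)) (B B' : Subtype P) (x : X) (hx : x ∈ B.1)
      (hx' : x ∈ B'.1) :
      partialι F P B x hx ≫ s.ι.app B = partialι F P B' x hx' ≫ s.ι.app B' := by
    obtain ⟨B'', h, h'⟩ := hP' B B'
    rw [← s.w (homOfLE h), ← s.w (homOfLE h'), ← Category.assoc, ← Category.assoc,
      partialι_map, partialι_map]
  -- `Q x y` is a member containing both indices; two are needed to check naturality along `x ⟶ y`.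
  choose Q hQ hQ₁ hQ₂ using hP
  let d (s : Cocone (partialColimit F P)) : Cocone F :=
    { pt := s.pt
      ι :=
        { app := fun x => partialι F P ⟨Q x x, hQ x x⟩ x (hQ₁ x x) ≫ s.ι.app _
          naturality := fun x y f => by
            rw [hι s _ ⟨Q x y, hQ x y⟩ y _ (hQ₂ x y), hι s _ ⟨Q x y, hQ x y⟩ x _ (hQ₁ x y)]
            rw [← Category.assoc, map_partialι]
            exact (Category.comp_id _).symm } }
  exact
    { desc := fun s => hc.desc (d s)
      fac := fun s B => partial_hom_ext fun x hx => by
        change partialι F P B x hx ≫ partialToPt P c B ≫ hc.desc (d s) = _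
        rw [← Category.assoc, partialι_toPt, hc.fac]
        exact hι s _ _ _ _ _
      uniq := fun s m hm => hc.hom_ext fun x => by
        rw [hc.fac]
        have h := partialι_toPt P c ⟨Q x x, hQ x x⟩ x (hQ₁ x x) =≫ m
        exact h.symm.trans ((Category.assoc _ _ _).trans (congr_arg _ (hm _))) }

end PartialColimits

/-! ### Raising the index of accessibility. -/

section Raising

variable {C : Type u} [Category.{v} C] {κ κ' : Cardinal.{w}} [Fact κ.IsRegular]
  [Fact κ'.IsRegular]

/-- If `J` is a `κ`-filtered category, a colimit of shape `J` is also a colimit of shape a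
`κ`-directed poset. -/
lemma exists_poset_colimitsOfShape {P : ObjectProperty C} (hP : P.IsCardinalFilteredGenerator κ)
    (A : C) : ∃ (X : Type w) (_ : PartialOrder X) (_ : IsCardinalFiltered X κ),
      P.colimitsOfShape X A := by
  obtain ⟨J, _, _, ⟨p⟩⟩ := hP.exists_colimitsOfShape A
  obtain ⟨X, _, _, F, _⟩ := IsCardinalFiltered.exists_cardinal_directed J κ
  exact ⟨X, inferInstance, inferInstance, ⟨{
    diag := F ⋙ p.diag
    ι := Functor.whiskerLeft F p.ι
    isColimit := (Functor.Final.isColimitWhiskerEquiv F _).symm p.isColimit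
    prop_diag_obj := fun x => p.prop_diag_obj _ }⟩⟩

lemma hasCardinalLT_arrow_of_preorder {B : Type w} [Preorder B] (hB : HasCardinalLT B κ) :
    HasCardinalLT (Arrow B) κ :=
  (hasCardinalLT_prod (Cardinal.IsRegular.aleph0_le Fact.out) hB hB).of_injective
    (fun f => (f.left, f.right)) (by
      rintro ⟨x, y, f⟩ ⟨x', y', f'⟩ h
      obtain ⟨rfl, rfl⟩ : x = x' ∧ y = y' := by simpa using h
      exact congr_arg _ (Subsingleton.elim (α := (x ⟶ y)) f f'))

lemma isCardinalPresentable_of_isColimit_poset [LocallySmall.{w} C] {B : Type w} [PartialOrder B]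
    (hB : HasCardinalLT B κ') {F : B ⥤ C} {c : Cocone F} (hc : IsColimit c)
    (hF : ∀ b, IsCardinalPresentable (F.obj b) κ') : IsCardinalPresentable c.pt κ' :=
  isCardinalPresentable_of_isColimit c hc κ' (hasCardinalLT_arrow_of_preorder hB)

/-- Each object is a colimit of objects of `P` over a `κ`-directed poset. The `κ`-directed subsets
of size `< κ'` are cofinal among all subsets of size `< κ'`, so they form a `κ'`-directed family,
and the object is the colimit of its partial colimits over them. -/
lemma isCardinalFilteredGenerator_of_dominates (h : Dominates κ κ')
    [HasCardinalFilteredColimits C κ] {P Q : ObjectProperty C}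
    (hP : P.IsCardinalFilteredGenerator κ) (hQ : Q ≤ isCardinalPresentable C κ')
    (hPQ : ∀ (B : Type w) [PartialOrder B] [IsCardinalFiltered B κ], HasCardinalLT B κ' →
      P.colimitsOfShape B ≤ Q) :
    Q.IsCardinalFilteredGenerator κ' where
  le_isCardinalPresentable := hQ
  exists_colimitsOfShape A := by
    obtain ⟨X, _, _, ⟨p⟩⟩ := exists_poset_colimitsOfShape hP A
    let G (S : Set X) (z : X) : Prop := ∀ x ∈ S, x ≤ z
    let R (B : Set X) : Prop := HasCardinalLT B κ' ∧ IsClosedFor κ G B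
    have hG (S : Set X) (hS : #S < κ) : ∃ z, G S z :=
      have hS' : HasCardinalLT S κ := by rwa [hasCardinalLT_iff_cardinal_mk_lt]
      ⟨IsCardinalFiltered.max (fun x : S => x.1) hS', fun x hx =>
        leOfHom (IsCardinalFiltered.toMax (fun x : S => x.1) hS' ⟨x, hx⟩)⟩
    have hR (A : Set X) (hA : HasCardinalLT A κ') : ∃ B, A ⊆ B ∧ R B := by
      obtain ⟨B, hAB, hB, hB', -⟩ := h.exists_isClosedFor hG id A hA
      exact ⟨B, hAB, hB, hB'⟩
    have hfilt (B : Subtype R) : IsCardinalFiltered B.1 κ :=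
      B.2.2.isCardinalFiltered fun _ _ h => h
    have (B : Subtype R) : HasColimit (restrict p.diag B.1) := by
      have := HasCardinalFilteredColimits.hasColimitsOfShape C κ B.1
      infer_instance
    have : IsCardinalFiltered (Subtype R) κ' := isCardinalFiltered_subtype (fun B hB => hB.1) hR
    have hκ' : ℵ₀ ≤ κ' := Cardinal.IsRegular.aleph0_le Fact.out
    have := isFiltered_of_isCardinalFiltered (Subtype R) κ'
    exact ⟨Subtype R, inferInstance, inferInstance, ⟨{
      diag := partialColimit p.diag R
      ι := (partialCocone R (Cocone.mk A p.ι)).ι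
      isColimit := isColimitPartialCocone p.isColimit
        (fun x y => by
          obtain ⟨B, hB, hB'⟩ := hR {x, y} (hasCardinalLT_of_finite _ _ hκ')
          exact ⟨B, hB', hB (by simp), hB (by simp)⟩)
        (fun B B' => ⟨IsFiltered.max B B', leOfHom (IsFiltered.leftToMax _ _),
          leOfHom (IsFiltered.rightToMax _ _)⟩)
      prop_diag_obj := fun B => hPQ B.1 B.2.1 _ ⟨{
        diag := restrict p.diag B.1
        ι := (colimit.cocone _).ι
        isColimit := colimit.isColimit _
        prop_diag_obj := fun x => p.prop_diag_obj _ }⟩ }⟩⟩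

lemma Dominates.isCardinalFilteredGenerator (h : Dominates κ κ')
    [IsCardinalAccessibleCategory C κ] :
    (isCardinalPresentable C κ').IsCardinalFilteredGenerator κ' := by
  obtain ⟨P, _, hP⟩ := HasCardinalFilteredGenerator.exists_generator C κ
  refine isCardinalFilteredGenerator_of_dominates h hP le_rfl ?_
  rintro B _ _ hB A ⟨p⟩
  exact isCardinalPresentable_of_isColimit_poset hB p.isColimit fun b =>
    isCardinalPresentable_monotone C h.le _ (hP.le_isCardinalPresentable _ (p.prop_diag_obj b))

lemma HasCardinalFilteredColimits.of_le (h : κ ≤ κ') [HasCardinalFilteredColimits C κ] :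
    HasCardinalFilteredColimits C κ' where
  hasColimitsOfShape J _ _ :=
    have := IsCardinalFiltered.of_le J h
    HasCardinalFilteredColimits.hasColimitsOfShape C κ J

lemma Dominates.isCardinalAccessibleCategory (h : Dominates κ κ')
    [IsCardinalAccessibleCategory C κ] : IsCardinalAccessibleCategory C κ' := by
  obtain ⟨P, _, hP⟩ := HasCardinalFilteredGenerator.exists_generator C κ
  have hP' : P ≤ isCardinalPresentable C κ' :=
    hP.le_isCardinalPresentable.trans (isCardinalPresentable_monotone C h.le)
  have : HasCardinalFilteredColimits C κ' := HasCardinalFilteredColimits.of_le h.le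
  -- The closure of `P` under `κ'`-small colimits inherits essential smallness from `P`, while this
  -- is not yet known for the class of all `κ'`-presentable objects.
  have hQ : (P.colimitsCardinalClosure κ').IsCardinalFilteredGenerator κ' := by
    refine isCardinalFilteredGenerator_of_dominates h hP
      (P.colimitsCardinalClosure_le_isCardinalPresentable hP') ?_
    intro B _ _ hB
    have := P.isClosedUnderColimitsOfShape_colimitsCardinalClosure κ' B
      (hasCardinalLT_arrow_of_preorder hB)
    exact (ObjectProperty.colimitsOfShape_monotone B (P.le_colimitsCardinalClosure κ')).trans
      (ObjectProperty.colimitsOfShape_le _ _)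
  exact { hQ.hasCardinalFilteredGenerator with }

/-- If `T` is `κ`-accessible and sends a `κ`-filtered generator to `κ'`-presentable objects,
then it preserves `κ'`-presentable objects. -/
lemma Dominates.isCardinalPresentable_obj (h : Dominates κ κ')
    [IsCardinalAccessibleCategory C κ] (T : C ⥤ C) [T.IsCardinalAccessible κ]
    {P : ObjectProperty C} (hP : P.IsCardinalFilteredGenerator κ)
    (hT : ∀ Y, P Y → IsCardinalPresentable (T.obj Y) κ') (A : C) [IsCardinalPresentable A κ'] :
    IsCardinalPresentable (T.obj A) κ' := by
  -- Objects for which the claim holds already form a generator, so every `κ'`-presentable object is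
  -- a retract of one of them, and `T` preserves retracts.
  let Q : ObjectProperty C := fun Y =>
    IsCardinalPresentable Y κ' ∧ IsCardinalPresentable (T.obj Y) κ'
  have hQ : Q.IsCardinalFilteredGenerator κ' := by
    refine isCardinalFilteredGenerator_of_dominates h hP (fun _ hY => hY.1) ?_
    rintro B _ _ hB A ⟨p⟩
    have := T.preservesColimitsOfShape_of_isCardinalAccessible κ B
    exact ⟨isCardinalPresentable_of_isColimit_poset hB p.isColimit fun b =>
      isCardinalPresentable_monotone C h.le _ (hP.le_isCardinalPresentable _ (p.prop_diag_obj b)),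
      isCardinalPresentable_of_isColimit_poset hB (isColimitOfPreserves T p.isColimit) fun b =>
        hT _ (p.prop_diag_obj b)⟩
  have hA : isCardinalPresentable C κ' A := ‹IsCardinalPresentable A κ'›
  rw [hQ.isPresentable_eq_retractClosure] at hA
  obtain ⟨Y, hY, ⟨r⟩⟩ := hA
  exact ObjectProperty.prop_of_retract (isCardinalPresentable C κ') (r.map T) hY.2

end Raising

/-! ### Filtered colimits, presentability and smallness for algebras. -/

section PresentableAlgebras

variable {C : Type u} [Category.{v} C] (T : Monad C) (κ κ' : Cardinal.{w}) [Fact κ.IsRegular]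
  [Fact κ'.IsRegular]

lemma preservesColimitsOfShape_forget [T.toFunctor.IsCardinalAccessible κ]
    [HasCardinalFilteredColimits C κ] (J : Type w) [SmallCategory J] [IsCardinalFiltered J κ] :
    PreservesColimitsOfShape J T.forget := by
  have := T.toFunctor.preservesColimitsOfShape_of_isCardinalAccessible κ J
  have := HasCardinalFilteredColimits.hasColimitsOfShape C κ J
  infer_instance

lemma isCardinalAccessible_forget [T.toFunctor.IsCardinalAccessible κ]
    [HasCardinalFilteredColimits C κ] : T.forget.IsCardinalAccessible κ where
  preservesColimitOfShape J _ _ := preservesColimitsOfShape_forget T κ J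

lemma hasCardinalFilteredColimits_algebra [T.toFunctor.IsCardinalAccessible κ]
    [HasCardinalFilteredColimits C κ] : HasCardinalFilteredColimits T.Algebra κ where
  hasColimitsOfShape J _ _ := by
    have := T.toFunctor.preservesColimitsOfShape_of_isCardinalAccessible κ J
    have := HasCardinalFilteredColimits.hasColimitsOfShape C κ J
    exact ⟨fun D => Monad.forget_creates_colimits_of_monad_preserves D⟩

/-- An algebra is `κ`-presentable if `A` and `T A` are, where `A` is its underlying object. -/
lemma isCardinalPresentable_algebra [LocallySmall.{w} C] [T.toFunctor.IsCardinalAccessible κ]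
    [HasCardinalFilteredColimits C κ] (A : T.Algebra) [IsCardinalPresentable A.A κ]
    [IsCardinalPresentable (T.obj A.A) κ] : IsCardinalPresentable A κ where
  preservesColimitOfShape J _ _ := ⟨fun {F} => ⟨fun {c} hc => ⟨by
    have := preservesColimitsOfShape_forget T κ J
    have := isFiltered_of_isCardinalFiltered J κ
    have hc' := isColimitOfPreserves T.forget hc
    refine Types.FilteredColimit.isColimitOf' _ _ (fun f => ?_) (fun j f g h => ?_)
    · change A ⟶ c.pt at f
      obtain ⟨j, g, hg⟩ := IsCardinalPresentable.exists_hom_of_isColimit κ hc'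
        (show A.A ⟶ (T.forget.mapCocone c).pt from f.f)
      let cι (j : J) : F.obj j ⟶ c.pt := c.ι.app j
      change A.A ⟶ (F.obj j).A at g
      change g ≫ (cι j).f = f.f at hg
      -- The factorization `g` need not be a morphism of algebras, but the two sides of the required
      -- identity agree in the colimit; as `T A` is presentable, they agree at a later stage.
      obtain ⟨k, a, ha⟩ := IsCardinalPresentable.exists_eq_of_isColimit' κ hc'
        (X := T.obj A.A) (i := j) (T.map g ≫ (F.obj j).a) (A.a ≫ g) (by
          change (T.map g ≫ (F.obj j).a) ≫ (cι j).f = (A.a ≫ g) ≫ (cι j).f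
          rw [Category.assoc, ← (cι j).h, Category.assoc, hg, ← f.h, ← hg, T.map_comp,
            Category.assoc])
      change (T.map g ≫ (F.obj j).a) ≫ (F.map a).f = (A.a ≫ g) ≫ (F.map a).f at ha
      refine ⟨k, ({ f := g ≫ (F.map a).f, h := ?_ } : A ⟶ F.obj k), ?_⟩
      · rw [T.map_comp, Category.assoc, (F.map a).h, ← Category.assoc, ha, Category.assoc]
      · have h1 : (F.map a).f ≫ (cι k).f = (cι j).f := congr_arg (·.f) (c.w a)
        apply Monad.Algebra.Hom.ext
        change f.f = (g ≫ (F.map a).f) ≫ (cι k).f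
        rw [Category.assoc, h1, hg]
    · change A ⟶ F.obj j at f g
      obtain ⟨k, a, ha⟩ := IsCardinalPresentable.exists_eq_of_isColimit' κ hc'
        (X := A.A) (i := j) f.f g.f (congr_arg (·.f) h)
      exact ⟨k, a, Monad.Algebra.Hom.ext ha⟩⟩⟩⟩

lemma locallySmall_algebra [LocallySmall.{w} C] : LocallySmall.{w} T.Algebra :=
  locallySmall_of_faithful T.forget

/-- The algebras whose underlying object belongs to an essentially small class of objects form
an essentially small class. -/
lemma essentiallySmall_algebra [LocallySmall.{w} C] (P : ObjectProperty C)
    [ObjectProperty.EssentiallySmall.{w} P] :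
    ObjectProperty.EssentiallySmall.{w} (P.inverseImage T.forget) := by
  obtain ⟨Q, _, -, hPQ⟩ := ObjectProperty.EssentiallySmall.exists_small_le.{w} P
  let I := Σ X : Subtype Q, { a : T.obj X.1 ⟶ X.1 //
    T.η.app X.1 ≫ a = 𝟙 X.1 ∧ T.μ.app X.1 ≫ a = T.map a ≫ a }
  let alg (i : I) : T.Algebra := ⟨i.1.1, i.2.1, i.2.2.1, i.2.2.2⟩
  refine ⟨ObjectProperty.ofObj alg, inferInstance, fun A hA => ?_⟩
  obtain ⟨X, hX, ⟨e⟩⟩ := hPQ _ hA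
  change A.A ≅ X at e
  let i : I := ⟨⟨X, hX⟩, T.map e.inv ≫ A.a ≫ e.hom, by
      have := T.η.naturality e.inv
      dsimp at this ⊢
      rw [← Category.assoc, ← this, Category.assoc, A.unit_assoc, e.inv_hom_id], by
      have := T.μ.naturality e.inv
      dsimp at this ⊢
      rw [← Category.assoc, ← this]
      have h : T.map (A.a ≫ e.hom) ≫ T.map e.inv = T.map A.a := by
        rw [← T.map_comp, Category.assoc, e.hom_inv_id, Category.comp_id]
      rw [Category.assoc, A.assoc_assoc, T.map_comp, Category.assoc,
        ← Category.assoc (T.map (A.a ≫ e.hom)), h]⟩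
  exact ⟨_, ⟨i⟩, ⟨Monad.Algebra.isoMk e (by
    change T.map e.hom ≫ T.map e.inv ≫ A.a ≫ e.hom = A.a ≫ e.hom
    rw [← T.map_comp_assoc, e.hom_inv_id, T.map_id, Category.id_comp])⟩⟩

end PresentableAlgebras

/-! ### Approximating the structure map of an algebra along a directed diagram. -/

section PartialAlgebras

variable {C : Type u} [Category.{v} C] {T : Monad C} {A : T.Algebra}
  {X : Type w} [PartialOrder X] {F : X ⥤ C}

/-- Given an algebra `A` and a diagram `F` over `A.A` indexed by a poset, approximations
`T (F x) ⟶ F (φ x)` of the structure morphism `T A ⟶ A` compatible with the unit. -/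
structure Approx (A : T.Algebra) (F : X ⥤ C) (ι : ∀ x, F.obj x ⟶ A.A) where
  /-- the index of the target -/
  φ : X → X
  /-- the inequality `x ≤ φ x` -/
  toφ : ∀ x, x ⟶ φ x
  /-- the approximation of the structure morphism -/
  u : ∀ x, T.obj (F.obj x) ⟶ F.obj (φ x)
  u_ι : ∀ x, u x ≫ ι (φ x) = T.map (ι x) ≫ A.a
  η_u : ∀ x, T.η.app (F.obj x) ≫ u x = F.map (toφ x)

/-- The cocone given by a compatible family of morphisms to `Z`. -/
abbrev familyCocone {Z : C} (ι : ∀ x, F.obj x ⟶ Z) (hι : ∀ {x y} (f : x ⟶ y), F.map f ≫ ι y = ι x) :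
    Cocone F where
  pt := Z
  ι :=
    { app := ι
      naturality := fun _ _ f => (hι f).trans (Category.comp_id _).symm }

variable {ι : ∀ x, F.obj x ⟶ A.A} {hι : ∀ {x y} (f : x ⟶ y), F.map f ≫ ι y = ι x}

/-- Presentability of `T (F x)` factors `T (F x) ⟶ T A ⟶ A` through some stage. The unit law holds
in `A`, so presentability of `F x` makes it hold after passing to a later stage. Neither naturality
nor associativity is obtained here. -/
lemma exists_approx {κ : Cardinal.{w}} [Fact κ.IsRegular] [IsCardinalFiltered X κ]
    (hc : IsColimit (familyCocone ι hι)) (hF : ∀ x, IsCardinalPresentable (F.obj x) κ)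
    (hTF : ∀ x, IsCardinalPresentable (T.obj (F.obj x)) κ) : Nonempty (Approx A F ι) := by
  have h (x : X) : ∃ (y : X) (p : x ⟶ y) (u : T.obj (F.obj x) ⟶ F.obj y),
      u ≫ ι y = T.map (ι x) ≫ A.a ∧ T.η.app (F.obj x) ≫ u = F.map p := by
    obtain ⟨j, f, hf⟩ := IsCardinalPresentable.exists_hom_of_isColimit κ hc (T.map (ι x) ≫ A.a)
    change f ≫ ι j = _ at hf
    obtain ⟨k, p, q, h⟩ := IsCardinalPresentable.exists_eq_of_isColimit κ hc
      (T.η.app (F.obj x) ≫ f) (𝟙 (F.obj x)) (by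
        change (T.η.app (F.obj x) ≫ f) ≫ ι j = 𝟙 (F.obj x) ≫ ι x
        have := T.η.naturality (ι x)
        dsimp at this
        rw [Category.assoc, hf, ← Category.assoc, ← this, Category.assoc, A.unit,
          Category.comp_id, Category.id_comp])
    exact ⟨k, q, f ≫ F.map p, by rw [Category.assoc, hι, hf],
      (Category.assoc _ _ _).symm.trans (h.trans (Category.id_comp _))⟩
  choose φ p u hu hη using h
  exact ⟨⟨φ, p, u, hu, hη⟩⟩

namespace Approx

variable (D : Approx A F ι)

/-- The condition that, after composing with a morphism to `F z`, the approximations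
at `x` are compatible with the multiplication of the monad. -/
def AssocAt (x z : X) : Prop :=
  ∃ (f : D.φ x ⟶ z) (g : D.φ (D.φ x) ⟶ z),
    T.μ.app (F.obj x) ≫ D.u x ≫ F.map f = T.map (D.u x) ≫ D.u (D.φ x) ≫ F.map g

/-- The condition that, after composing with a morphism to `F z`, the approximations
at `x` and `y` are compatible. -/
def NatAt (x y z : X) : Prop :=
  ∀ h : x ⟶ y, ∃ (f : D.φ x ⟶ z) (g : D.φ y ⟶ z),
    T.map (F.map h) ≫ D.u y ≫ F.map g = D.u x ≫ F.map f

variable {D}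

lemma AssocAt.of_le {x z z' : X} (h : D.AssocAt x z) (hz : z ≤ z') : D.AssocAt x z' := by
  obtain ⟨f, g, h⟩ := h
  refine ⟨f ≫ homOfLE hz, g ≫ homOfLE hz, ?_⟩
  simp only [F.map_comp]
  have := h =≫ F.map (homOfLE hz)
  simpa only [Category.assoc] using this

lemma NatAt.of_le {x y z z' : X} (h : D.NatAt x y z) (hz : z ≤ z') : D.NatAt x y z' := by
  intro p
  obtain ⟨f, g, h⟩ := h p
  refine ⟨f ≫ homOfLE hz, g ≫ homOfLE hz, ?_⟩
  simp only [F.map_comp]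
  have := h =≫ F.map (homOfLE hz)
  simpa only [Category.assoc] using this

variable (D) in
/-- The relation between subsets and elements of the index poset used in order to find subsets such
that the colimit over these subsets are algebras. -/
def Bounds (S : Set X) (z : X) : Prop :=
  (∀ x ∈ S, x ≤ z) ∧ (∀ x ∈ S, D.AssocAt x z) ∧ ∀ x ∈ S, ∀ y ∈ S, D.NatAt x y z

variable {κ : Cardinal.{w}} [Fact κ.IsRegular] [IsCardinalFiltered X κ]

/-- Both sides become equal in `A` by associativity of the algebra, and `T (T (F x))` is
presentable. -/
lemma exists_assocAt (hc : IsColimit (familyCocone ι hι))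
    (hTF : ∀ x, IsCardinalPresentable (T.obj (T.obj (F.obj x))) κ) (x : X) :
    ∃ z, D.AssocAt x z := by
  obtain ⟨k, f, g, h⟩ := IsCardinalPresentable.exists_eq_of_isColimit κ hc
    (X := T.obj (T.obj (F.obj x))) (T.μ.app (F.obj x) ≫ D.u x) (T.map (D.u x) ≫ D.u (D.φ x)) (by
      change (T.μ.app (F.obj x) ≫ D.u x) ≫ ι _ = (T.map (D.u x) ≫ D.u (D.φ x)) ≫ ι _
      have := T.μ.naturality (ι x)
      dsimp at this
      rw [Category.assoc, D.u_ι, Category.assoc, D.u_ι, ← T.map_comp_assoc, D.u_ι,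
        ← Category.assoc, ← this, Category.assoc, A.assoc, T.map_comp_assoc])
  exact ⟨k, f, g, (Category.assoc _ _ _).symm.trans (h.trans (Category.assoc _ _ _))⟩

lemma exists_natAt (hc : IsColimit (familyCocone ι hι))
    (hTF : ∀ x, IsCardinalPresentable (T.obj (F.obj x)) κ) (x y : X) :
    ∃ z, D.NatAt x y z := by
  by_cases p : x ≤ y
  · obtain ⟨k, g, f, h⟩ := IsCardinalPresentable.exists_eq_of_isColimit κ hc
      (T.map (F.map (homOfLE p)) ≫ D.u y) (D.u x) (by
        change (T.map (F.map (homOfLE p)) ≫ D.u y) ≫ ι _ = D.u x ≫ ι _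
        rw [Category.assoc, D.u_ι, D.u_ι, ← T.map_comp_assoc, hι])
    exact ⟨k, fun _ => ⟨f, g, (Category.assoc _ _ _).symm.trans h⟩⟩
  · exact ⟨x, fun q => absurd (leOfHom q) p⟩

/-- One upper bound is taken for the elements of `S`, their associativity witnesses and the
naturality witnesses of pairs; these are still fewer than `κ`, and each condition persists at larger
indices. -/
lemma exists_bounds (hc : IsColimit (familyCocone ι hι))
    (hTF : ∀ x, IsCardinalPresentable (T.obj (F.obj x)) κ)
    (hTTF : ∀ x, IsCardinalPresentable (T.obj (T.obj (F.obj x))) κ) (S : Set X)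
    (hS : HasCardinalLT S κ) : ∃ z, D.Bounds S z := by
  choose z hz using D.exists_assocAt hc hTTF
  choose z' hz' using D.exists_natAt hc hTF
  have hκ : ℵ₀ ≤ κ := Cardinal.IsRegular.aleph0_le Fact.out
  have h₁ : HasCardinalLT (S ⊕ S × S) κ := by
    rw [hasCardinalLT_sum_iff _ _ _ hκ]
    exact ⟨hS, hasCardinalLT_prod hκ hS hS⟩
  have h₂ : HasCardinalLT (S ⊕ (S ⊕ S × S)) κ := by
    rw [hasCardinalLT_sum_iff _ _ _ hκ]
    exact ⟨hS, h₁⟩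
  let f : S ⊕ (S ⊕ S × S) → X :=
    Sum.elim (fun x => x.1) (Sum.elim (fun x => z x.1) (fun x => z' x.1.1 x.2.1))
  have hf (i) : f i ≤ IsCardinalFiltered.max f h₂ := leOfHom (IsCardinalFiltered.toMax f h₂ i)
  exact ⟨IsCardinalFiltered.max f h₂, fun x hx => hf (Sum.inl ⟨x, hx⟩),
    fun x hx => (hz x).of_le (hf (Sum.inr (Sum.inl ⟨x, hx⟩))),
    fun x hx y hy => (hz' x y).of_le (hf (Sum.inr (Sum.inr (⟨x, hx⟩, ⟨y, hy⟩))))⟩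

end Approx

end PartialAlgebras

/-! ### Images of partial colimits under functors preserving them. -/

section PartialColimitsFunctor

variable {C : Type u} [Category.{v} C] {C' : Type u'} [Category.{v'} C'] {X : Type w}
  [PartialOrder X] {F : X ⥤ C} {P : Set X → Prop} [∀ B : Subtype P, HasColimit (restrict F B.1)]
  (G : C ⥤ C') [∀ B : Subtype P, PreservesColimit (restrict F B.1) G]

lemma map_partial_hom_ext {B : Subtype P} {Z : C'} {f g : G.obj ((partialColimit F P).obj B) ⟶ Z}
    (h : ∀ x hx, G.map (partialι F P B x hx) ≫ f = G.map (partialι F P B x hx) ≫ g) : f = g :=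
  (isColimitOfPreserves G (colimit.isColimit (restrict F B.1))).hom_ext fun x => h x.1 x.2

/-- Morphisms from the image of the colimit over a subset by a functor which preserves it. -/
noncomputable def mapPartialDesc {B : Subtype P} {Z : C'} (f : ∀ x ∈ B.1, G.obj (F.obj x) ⟶ Z)
    (hf : ∀ x hx y hy (h : x ⟶ y), G.map (F.map h) ≫ f y hy = f x hx) :
    G.obj ((partialColimit F P).obj B) ⟶ Z :=
  (isColimitOfPreserves G (colimit.isColimit (restrict F B.1))).desc
    { pt := Z
      ι :=
        { app := fun x => f x.1 x.2
          naturality := fun x y h =>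
            (hf x.1 x.2 y.1 y.2 (homOfLE (leOfHom h))).trans (Category.comp_id _).symm } }

lemma map_partialι_desc {B : Subtype P} {Z : C'} (f : ∀ x ∈ B.1, G.obj (F.obj x) ⟶ Z)
    (hf : ∀ x hx y hy (h : x ⟶ y), G.map (F.map h) ≫ f y hy = f x hx) (x : X) (hx : x ∈ B.1) :
    G.map (partialι F P B x hx) ≫ mapPartialDesc G f hf = f x hx :=
  (isColimitOfPreserves G (colimit.isColimit (restrict F B.1))).fac _ ⟨x, hx⟩

end PartialColimitsFunctor

/-! ### Algebra structures on partial colimits. -/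

section PartialAlgebras

variable {C : Type u} [Category.{v} C] {T : Monad C} {A : T.Algebra}
  {X : Type w} [PartialOrder X] {F : X ⥤ C} {ι : ∀ x, F.obj x ⟶ A.A}
  {P : Set X → Prop} [∀ B : Subtype P, HasColimit (restrict F B.1)]
  [∀ B : Subtype P, PreservesColimit (restrict F B.1) T.toFunctor]

namespace Approx

variable (D : Approx A F ι)

variable (P) in
/-- The condition that the subsets satisfying `P` are closed under the index function of the
approximations, and that they are directed in a way compatible with the approximations. -/
structure IsCompatible : Prop where
  φ_mem : ∀ B, P B → ∀ x ∈ B, D.φ x ∈ B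
  exists_bounds : ∀ B, P B → ∀ x ∈ B, ∀ y ∈ B, ∃ z ∈ B, D.Bounds {x, y} z

variable {D} (hD : D.IsCompatible P)

/-- The structure morphism of the colimit over a subset. -/
noncomputable def partialAct (B : Subtype P) :
    T.obj ((partialColimit F P).obj B) ⟶ (partialColimit F P).obj B :=
  mapPartialDesc T.toFunctor
    (fun x hx => D.u x ≫ partialι F P B (D.φ x) (hD.φ_mem _ B.2 x hx))
    (fun x hx y hy h => by
      -- The maps `u x` are natural only after passing to a later index; that index lies in `B`, so
      -- the discrepancy vanishes in the colimit over `B`.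
      obtain ⟨z, hz, -, -, hz'⟩ := hD.exists_bounds _ B.2 x hx y hy
      obtain ⟨f, g, hfg⟩ := hz' x (by simp) y (by simp) h
      rw [← map_partialι F P B g _ hz, ← map_partialι F P B f _ hz, ← Category.assoc,
        ← Category.assoc, ← Category.assoc, ← hfg]
      simp only [Category.assoc])

lemma map_partialι_act (B : Subtype P) (x : X) (hx : x ∈ B.1) :
    T.map (partialι F P B x hx) ≫ partialAct hD B =
      D.u x ≫ partialι F P B (D.φ x) (hD.φ_mem _ B.2 x hx) :=
  map_partialι_desc T.toFunctor _ _ x hx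

lemma partialAct_map {B B' : Subtype P} (h : B ⟶ B') :
    T.map ((partialColimit F P).map h) ≫ partialAct hD B' =
      partialAct hD B ≫ (partialColimit F P).map h :=
  map_partial_hom_ext T.toFunctor fun x hx => by
    rw [← Category.assoc, ← T.map_comp, partialι_map, map_partialι_act, ← Category.assoc,
      map_partialι_act, Category.assoc, partialι_map]

lemma η_partialAct (B : Subtype P) :
    T.η.app ((partialColimit F P).obj B) ≫ partialAct hD B = 𝟙 _ :=
  partial_hom_ext fun x hx => by
    have := T.η.naturality (partialι F P B x hx)
    dsimp at this
    rw [← Category.assoc, this, Category.assoc, map_partialι_act, ← Category.assoc, D.η_u,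
      map_partialι]
    exact (Category.comp_id _).symm

variable [∀ B : Subtype P, PreservesColimit (restrict F B.1) (T.toFunctor ⋙ T.toFunctor)]

/-- Since `T ⋙ T` preserves the colimit over `B`, the law can be tested on each `T (T (F x))`, where
it holds after passing to an index inside `B`. -/
lemma μ_partialAct (B : Subtype P) :
    T.μ.app ((partialColimit F P).obj B) ≫ partialAct hD B =
      T.map (partialAct hD B) ≫ partialAct hD B :=
  map_partial_hom_ext (T.toFunctor ⋙ T.toFunctor) fun x hx => by
    obtain ⟨z, hz, -, hz', -⟩ := hD.exists_bounds _ B.2 x hx x hx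
    obtain ⟨f, g, hfg⟩ := hz' x (by simp)
    have h := hD.φ_mem _ B.2
    have h₁ := T.μ.naturality (partialι F P B x hx)
    dsimp at h₁ ⊢
    rw [← Category.assoc, h₁, Category.assoc, map_partialι_act,
      ← Category.assoc (T.map (T.map _)), ← T.map_comp,
      map_partialι_act, T.map_comp, Category.assoc, map_partialι_act,
      ← map_partialι F P B f (h _ hx) hz, ← map_partialι F P B g (h _ (h _ hx)) hz]
    have h₂ := hfg =≫ partialι F P B z hz
    simpa only [Category.assoc] using h₂

/-- The functor sending a subset to the algebra given by the colimit over this subset. -/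
noncomputable def partialAlgebra : Subtype P ⥤ T.Algebra where
  obj B :=
    { A := (partialColimit F P).obj B
      a := partialAct hD B
      unit := η_partialAct hD B
      assoc := μ_partialAct hD B }
  map h :=
    { f := (partialColimit F P).map h
      h := partialAct_map hD h }
  map_id B := Monad.Algebra.Hom.ext ((partialColimit F P).map_id B)
  map_comp f g := Monad.Algebra.Hom.ext ((partialColimit F P).map_comp f g)

variable {hι : ∀ {x y} (f : x ⟶ y), F.map f ≫ ι y = ι x}

omit [∀ B : Subtype P, PreservesColimit (restrict F B.1) (T.toFunctor ⋙ T.toFunctor)] in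
lemma partialAct_toPt (B : Subtype P) :
    T.map (partialToPt P (familyCocone ι hι) B) ≫ A.a =
      partialAct hD B ≫ partialToPt P (familyCocone ι hι) B :=
  map_partial_hom_ext T.toFunctor fun x hx => by
    rw [← Category.assoc, ← T.map_comp, partialι_toPt, ← Category.assoc, map_partialι_act,
      Category.assoc, partialι_toPt]
    exact (D.u_ι x).symm

/-- The cocone with point the given algebra over the algebras given by partial colimits. -/
noncomputable def partialAlgebraCocone (hι : ∀ {x y} (f : x ⟶ y), F.map f ≫ ι y = ι x) :
    Cocone (partialAlgebra hD) where
  pt := A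
  ι :=
    { app := fun B =>
        { f := partialToPt P (familyCocone ι hι) B
          h := partialAct_toPt hD B }
      naturality := fun _ _ h => Monad.Algebra.Hom.ext
        ((map_partialToPt P (familyCocone ι hι) h).trans (Category.comp_id _).symm) }

end Approx

end PartialAlgebras

/-! ### Accessibility of categories of algebras. -/

section Main

variable {C : Type u} [Category.{v} C] (T : Monad C) {κ κ' : Cardinal.{w}} [Fact κ.IsRegular]
  [Fact κ'.IsRegular]

/-- The two cardinals play different roles: the diagram is `κ'`-directed with `κ'`-presentable
values, whereas the chosen subsets are only `κ`-directed. This suffices for `T` to preserve their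
colimits, and their size `< κ'` keeps these colimits `κ'`-presentable. -/
lemma isCardinalFilteredGenerator_algebra [LocallySmall.{w} C] (h : Dominates κ κ')
    [HasCardinalFilteredColimits C κ] [T.toFunctor.IsCardinalAccessible κ]
    (hC : (isCardinalPresentable C κ').IsCardinalFilteredGenerator κ')
    (hT : ∀ A, IsCardinalPresentable A κ' → IsCardinalPresentable (T.obj A) κ') :
    ((isCardinalPresentable C κ').inverseImage T.forget).IsCardinalFilteredGenerator κ' where
  le_isCardinalPresentable A hA := by
    have := T.toFunctor.isCardinalAccessible_of_le h.le
    have : HasCardinalFilteredColimits C κ' := HasCardinalFilteredColimits.of_le h.le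
    have hA' : IsCardinalPresentable A.A κ' := hA
    have := hT A.A hA'
    exact isCardinalPresentable_algebra T κ' A
  exists_colimitsOfShape A := by
    obtain ⟨X, _, _, ⟨p⟩⟩ := exists_poset_colimitsOfShape hC A.A
    have hF (x : X) : IsCardinalPresentable (p.diag.obj x) κ' := p.prop_diag_obj x
    let ι (x : X) : p.diag.obj x ⟶ A.A := p.ι.app x
    have hι {x y : X} (f : x ⟶ y) : p.diag.map f ≫ ι y = ι x := p.w f
    have hc : IsColimit (familyCocone ι hι) := p.isColimit
    obtain ⟨D⟩ := exists_approx hc hF (fun x => hT _ (hF x))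
    let P (B : Set X) : Prop :=
      HasCardinalLT B κ' ∧ IsClosedFor κ D.Bounds B ∧ ∀ x ∈ B, D.φ x ∈ B
    have hP (S : Set X) (hS : HasCardinalLT S κ') : ∃ B, S ⊆ B ∧ P B :=
      h.exists_isClosedFor (fun S hS => D.exists_bounds hc (fun x => hT _ (hF x))
        (fun x => hT _ (hT _ (hF x))) S
        (by rw [hasCardinalLT_iff_cardinal_mk_lt]; exact hS.trans_le h.le)) D.φ S hS
    have hκ : ℵ₀ ≤ κ := Cardinal.IsRegular.aleph0_le Fact.out
    have hD : D.IsCompatible P :=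
      { φ_mem := fun B hB => hB.2.2
        exists_bounds := fun B hB x hx y hy => hB.2.1 {x, y}
          (by rintro _ (rfl | rfl) <;> assumption) ((lt_aleph0_of_finite _).trans_le hκ) }
    have hfilt (B : Subtype P) : IsCardinalFiltered B.1 κ :=
      B.2.2.1.isCardinalFiltered fun _ _ h => h.1
    have (B : Subtype P) : HasColimit (restrict p.diag B.1) := by
      have := HasCardinalFilteredColimits.hasColimitsOfShape C κ B.1
      infer_instance
    have (B : Subtype P) : PreservesColimit (restrict p.diag B.1) T.toFunctor := by
      have := T.toFunctor.preservesColimitsOfShape_of_isCardinalAccessible κ B.1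
      infer_instance
    have (B : Subtype P) :
        PreservesColimit (restrict p.diag B.1) (T.toFunctor ⋙ T.toFunctor) := by
      have := (T.toFunctor ⋙ T.toFunctor).preservesColimitsOfShape_of_isCardinalAccessible κ B.1
      infer_instance
    have : IsCardinalFiltered (Subtype P) κ' := isCardinalFiltered_subtype (fun B hB => hB.1) hP
    have := isFiltered_of_isCardinalFiltered (Subtype P) κ'
    have hcP : IsColimit (partialCocone P (familyCocone ι hι)) := isColimitPartialCocone hc
      (fun x y => by
        obtain ⟨B, hB, hB'⟩ := hP {x, y} (hasCardinalLT_of_finite _ _ (hκ.trans h.le))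
        exact ⟨B, hB', hB (by simp), hB (by simp)⟩)
      (fun B B' => ⟨IsFiltered.max B B', leOfHom (IsFiltered.leftToMax _ _),
        leOfHom (IsFiltered.rightToMax _ _)⟩)
    have := T.toFunctor.isCardinalAccessible_of_le h.le
    have := T.toFunctor.preservesColimitsOfShape_of_isCardinalAccessible κ' (Subtype P)
    have : ReflectsColimit (Approx.partialAlgebra hD) T.forget := inferInstance
    exact ⟨Subtype P, inferInstance, inferInstance, ⟨{
      diag := Approx.partialAlgebra hD
      ι := (Approx.partialAlgebraCocone hD hι).ι
      -- `T` preserves `κ'`-filtered colimits, so the forgetful functor reflects them and the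
      -- colimit property is checked in `C`.
      isColimit := isColimitOfReflects T.forget (c := Approx.partialAlgebraCocone hD hι) hcP
      prop_diag_obj := fun B => isCardinalPresentable_of_isColimit_poset B.2.1
        (colimit.isColimit (restrict p.diag B.1)) (fun x => hF x.1) }⟩⟩

lemma isCardinalAccessibleCategory_algebra (h : Dominates κ κ')
    [IsCardinalAccessibleCategory C κ] [T.toFunctor.IsCardinalAccessible κ]
    {P : ObjectProperty C} (hP : P.IsCardinalFilteredGenerator κ)
    (hT : ∀ Y, P Y → IsCardinalPresentable (T.obj Y) κ') :
    IsCardinalAccessibleCategory T.Algebra κ' := by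
  have : IsCardinalAccessibleCategory C κ' := h.isCardinalAccessibleCategory
  have := T.toFunctor.isCardinalAccessible_of_le h.le
  have := locallySmall_algebra.{w} T
  have := essentiallySmall_algebra.{w} T (isCardinalPresentable C κ')
  have := hasCardinalFilteredColimits_algebra T κ'
  have hA := isCardinalFilteredGenerator_algebra T h h.isCardinalFilteredGenerator
    fun A _ => h.isCardinalPresentable_obj T.toFunctor hP hT A
  exact { hA.hasCardinalFilteredGenerator with }

/-- Each `T.obj Y` is presentable for some cardinal, and up to isomorphism only a small set of `Y`
matters, so a supremum of these cardinals works. -/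
lemma exists_isCardinalPresentable_obj [IsAccessibleCategory.{w} C] (T : C ⥤ C)
    (P : ObjectProperty C) [ObjectProperty.EssentiallySmall.{w} P] :
    ∃ θ : Cardinal.{w}, ∀ (κ : Cardinal.{w}) [Fact κ.IsRegular], θ ≤ κ → ∀ Y, P Y →
      IsCardinalPresentable (T.obj Y) κ := by
  obtain ⟨Q, _, -, hPQ⟩ := ObjectProperty.EssentiallySmall.exists_small_le.{w} P
  have h (Y : C) : ∃ (κ : Cardinal.{w}) (_ : Fact κ.IsRegular),
      IsCardinalPresentable (T.obj Y) κ :=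
    (inferInstance : IsPresentable.{w} (T.obj Y)).exists_cardinal
  choose κ hκ hκ' using h
  let f (i : Shrink.{w} (Subtype Q)) : Cardinal.{w} := κ ((equivShrink _).symm i).1
  refine ⟨iSup f, fun κ' _ hκ'' Y hY => ?_⟩
  obtain ⟨Z, hZ, ⟨e⟩⟩ := hPQ _ hY
  have h₁ : κ Z ≤ κ' := by
    refine le_trans ?_ hκ''
    have := le_ciSup (Cardinal.bddAbove_of_small (s := Set.range f)) (equivShrink _ ⟨Z, hZ⟩)
    simpa [f] using this
  have := isCardinalPresentable_of_le (T.obj Z) h₁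
  exact isCardinalPresentable_of_iso (T.mapIso e.symm) κ'

/-- The category of algebras over an accessible monad on an accessible category is accessible, and
the forgetful functor is accessible. -/
theorem isAccessible_algebra [IsAccessibleCategory.{w} C]
    [Functor.IsAccessible.{w} T.toFunctor] :
    IsAccessibleCategory.{w} T.Algebra ∧ Functor.IsAccessible.{w} T.forget := by
  obtain ⟨κ₁, _, _⟩ := IsAccessibleCategory.exists_cardinal.{w} C
  obtain ⟨κ₂, _, _⟩ := Functor.IsAccessible.exists_cardinal.{w} (F := T.toFunctor)
  -- First raising: it reaches a common index of accessibility for `C` and `T`.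
  obtain ⟨κ, hκ, hκ₂, h₁⟩ :=
    exists_dominates (κ := κ₁) (Cardinal.IsRegular.aleph0_le Fact.out) κ₂
  have : Fact κ.IsRegular := ⟨hκ⟩
  have : IsCardinalAccessibleCategory C κ := h₁.isCardinalAccessibleCategory
  have := T.toFunctor.isCardinalAccessible_of_le hκ₂
  obtain ⟨P, _, hP⟩ := HasCardinalFilteredGenerator.exists_generator C κ
  obtain ⟨θ, hθ⟩ := exists_isCardinalPresentable_obj.{w} T.toFunctor P
  -- Second raising: beyond `θ`, `T` sends the chosen generator to `κ'`-presentable objects, hence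
  -- preserves all `κ'`-presentable objects.
  obtain ⟨κ', hκ', hθκ', h⟩ := exists_dominates hκ.aleph0_le θ
  have : Fact κ'.IsRegular := ⟨hκ'⟩
  have := isCardinalAccessible_forget T κ
  exact ⟨⟨κ', inferInstance, isCardinalAccessibleCategory_algebra T h hP (hθ κ' hθκ')⟩,
    T.forget.isAccessible_of_isCardinalAccessible κ⟩

end Main

end AccessibleMonad

namespace EnrichedRep

/-! ### Representations of `M` as modules over the induced monad. -/

section Comparison

variable {V : Type u'} [Category.{v'} V] [MonoidalCategory V] [MonoidalClosed V]
  {C : Type u} [Category.{v} C] [EnrichedOrdinaryCategory V C] [Tensored V C] {M : Mon V}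

lemma tensorDesc_tensorUnit {N : V} {X Y : C} (f : Tensored.obj N X ⟶ Y) :
    tensorDesc (tensorUnit N X ≫ eHomWhiskerLeft V X f) = f :=
  tensor_hom_ext (tensorUnit_desc _)

lemma tensorDesc_eq_iff {N : V} {X Y : C} (f g : Tensored.obj N X ⟶ Y) :
    f = g ↔ tensorUnit N X ≫ eHomWhiskerLeft V X f = tensorUnit N X ≫ eHomWhiskerLeft V X g :=
  ⟨fun h => h ▸ rfl, tensor_hom_ext⟩

omit [MonoidalClosed V] [Tensored V C] in
lemma eHomEquiv_comp_eHomWhiskerLeft {X Y Z : C} (f : X ⟶ Y) (g : Y ⟶ Z) :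
    eHomEquiv V (f ≫ g) = eHomEquiv V f ≫ eHomWhiskerLeft V X g := by
  rw [eHomEquiv_comp]
  change (λ_ _).inv ≫ eStar _ _ = _
  rw [eStar_eHomEquiv, ← unitors_equal, Iso.inv_hom_id_assoc]

/-- The unit law of a module over `tensorMonad C M`, in terms of the morphism `M ⟶ [X, X]`. -/
lemma monadUnit_tensorDesc_iff {X : C} (a : M.X ⟶ (X ⟶[V] X)) :
    monadUnit M X ≫ tensorDesc a = 𝟙 X ↔ MonObj.one (X := M.X) ≫ a = eId V X := by
  rw [← (eHomEquiv V).injective.eq_iff, eHomEquiv_comp_eHomWhiskerLeft, eHomEquiv_monadUnit,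
    Category.assoc, tensorUnit_desc, eHomEquiv_id]

/-- The associativity law of a module over `tensorMonad C M`, in terms of the morphism
`M ⟶ [X, X]`. -/
lemma monadMul_tensorDesc_iff {X : C} (a : M.X ⟶ (X ⟶[V] X)) :
    monadMul M X ≫ tensorDesc a = tensorMap M.X (tensorDesc a) ≫ tensorDesc a ↔
      MonObj.mul (X := M.X) ≫ a = eStar a a := by
  have h₁ : eStar (tensorUnit M.X X) (tensorUnit M.X (Tensored.obj M.X X) ≫
      eHomWhiskerLeft V _ (monadMul M X ≫ tensorDesc a)) = MonObj.mul (X := M.X) ≫ a := by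
    rw [eHomWhiskerLeft_comp, ← Category.assoc, ← eStar_whiskerLeft, eStar_monadMul,
      Category.assoc, tensorUnit_desc]
  have h₂ : eStar (tensorUnit M.X X) (tensorUnit M.X (Tensored.obj M.X X) ≫
      eHomWhiskerLeft V _ (tensorMap M.X (tensorDesc a) ≫ tensorDesc a)) = eStar a a := by
    rw [eHomWhiskerLeft_comp, ← Category.assoc, tensorUnit_map, Category.assoc,
      ← eHom_whisker_exchange, ← Category.assoc, ← eStar_exchange, tensorUnit_desc]
  rw [← h₁, ← h₂]
  exact ⟨fun h => h ▸ rfl, fun h => tensor_hom_ext (eStar_ext h)⟩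

/-- The condition that a morphism is compatible with module structures, in terms of the
morphisms `M ⟶ [X, X]`. -/
lemma tensorMap_tensorDesc_iff {X Y : C} (f : X ⟶ Y) (a : M.X ⟶ (X ⟶[V] X))
    (b : M.X ⟶ (Y ⟶[V] Y)) :
    tensorMap M.X f ≫ tensorDesc b = tensorDesc a ≫ f ↔
      a ≫ eHomWhiskerLeft V X f = b ≫ eHomWhiskerRight V f Y := by
  have h₁ : tensorUnit M.X X ≫ eHomWhiskerLeft V X (tensorMap M.X f ≫ tensorDesc b) =
      b ≫ eHomWhiskerRight V f Y := by
    rw [eHomWhiskerLeft_comp, ← Category.assoc, tensorUnit_map, Category.assoc,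
      ← eHom_whisker_exchange, ← Category.assoc, tensorUnit_desc]
  have h₂ : tensorUnit M.X X ≫ eHomWhiskerLeft V X (tensorDesc a ≫ f) =
      a ≫ eHomWhiskerLeft V X f := by
    rw [eHomWhiskerLeft_comp, ← Category.assoc, tensorUnit_desc]
  rw [tensorDesc_eq_iff, h₁, h₂]
  exact eq_comm

variable (C M) in
/-- The functor sending a representation `(X, α)` to `X` with the module structure
corresponding to `α`. -/
noncomputable def Rep.toAlgebra : Rep C M ⥤ (tensorMonad C M).Algebra where
  obj R :=
    { A := R.X
      a := R.transpose
      unit := (monadUnit_tensorDesc_iff R.act).2 (IsMonHom.one_hom (f := R.α.hom))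
      assoc := (monadMul_tensorDesc_iff R.act).2 (IsMonHom.mul_hom (f := R.α.hom)) }
  map {R S} f :=
    { f := f.f
      h := (tensorMap_tensorDesc_iff f.f R.act S.act).2 f.comm }
  map_id _ := rfl
  map_comp _ _ := rfl

instance : (Rep.toAlgebra C M).Faithful where
  map_injective h := Rep.Hom.ext (congr_arg Monad.Algebra.Hom.f h)

instance : (Rep.toAlgebra C M).Full where
  map_surjective {R S} f := ⟨⟨f.f, (tensorMap_tensorDesc_iff f.f R.act S.act).1 f.h⟩, rfl⟩

instance : (Rep.toAlgebra C M).EssSurj where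
  mem_essImage A := by
    let a : M.X ⟶ (A.A ⟶[V] A.A) := tensorUnit M.X A.A ≫ eHomWhiskerLeft V A.A A.a
    have ha : tensorDesc a = A.a := tensorDesc_tensorUnit A.a
    have h₁ : MonObj.one (X := M.X) ≫ a = eId V A.A :=
      (monadUnit_tensorDesc_iff a).1 (ha ▸ A.unit)
    have h₂ : MonObj.mul (X := M.X) ≫ a = eStar a a :=
      (monadMul_tensorDesc_iff a).1 (ha ▸ A.assoc)
    let R : Rep C M :=
      { X := A.A
        α := { hom := a, isMonHom_hom := { one_hom := h₁, mul_hom := h₂ } } }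
    refine ⟨R, ⟨Monad.Algebra.isoMk (Iso.refl _) ?_⟩⟩
    -- The underlying isomorphism is the identity; the two structure maps agree because transposing
    -- `A.a` twice gives it back.
    have h := congr_arg (· ≫ A.a) ((tensorMonad C M).toFunctor.map_id A.A)
    exact h.trans ((Category.id_comp _).trans (ha.symm.trans (Category.comp_id _).symm))

instance : (Rep.toAlgebra C M).IsEquivalence where

end Comparison

end EnrichedRep

theorem mainTheorem3
    {V : Type u'} [Category.{v'} V] [MonoidalCategory V] [MonoidalClosed V]
    [HasLimitsOfSize.{w, w} V] [HasColimitsOfSize.{w, w} V]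
    {C : Type u} [Category.{v} C] [EnrichedOrdinaryCategory V C]
    [EnrichedRep.Tensored V C] [EnrichedRep.IsAccessiblyTensored.{w} V C] (M : Mon V) :
    (EnrichedRep.tensorMonad C M).toFunctor.IsAccessible.{w} ∧
    (∃ e : EnrichedRep.Rep C M ≌ (EnrichedRep.tensorMonad C M).Algebra,
      e.functor ⋙ (EnrichedRep.tensorMonad C M).forget = EnrichedRep.Rep.forget C M ∧
      ∀ R : EnrichedRep.Rep C M, ∃ h₁ h₂, e.functor.obj R = ⟨R.X, R.transpose, h₁, h₂⟩) ∧
    IsAccessibleCategory.{w} (EnrichedRep.Rep C M) ∧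
    (EnrichedRep.Rep.forget C M).IsAccessible.{w} := by
  have hC : IsAccessibleCategory.{w} C := EnrichedRep.IsAccessiblyTensored.accessible V
  have hT : (EnrichedRep.tensorMonad C M).toFunctor.IsAccessible.{w} :=
    EnrichedRep.IsAccessiblyTensored.accessible_tensorFunctor M.X
  obtain ⟨hA, hF⟩ := AccessibleMonad.isAccessible_algebra.{w} (EnrichedRep.tensorMonad C M)
  let e := (EnrichedRep.Rep.toAlgebra C M).asEquivalence
  -- An equivalence preserves all colimits, so any regular cardinal serves, here `ℵ₀`.
  have he : e.functor.IsAccessible.{w} :=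
    have : Fact Cardinal.aleph0.{w}.IsRegular := Cardinal.fact_isRegular_aleph0
    e.functor.isAccessible_of_isCardinalAccessible Cardinal.aleph0.{w}
  refine ⟨hT, ⟨e, rfl, fun R => ⟨_, _, rfl⟩⟩, e.symm.isAccessibleCategory, ?_⟩
  exact (inferInstance : (e.functor ⋙ (EnrichedRep.tensorMonad C M).forget).IsAccessible)
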